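/- Let $k$ be a field and let $Q$ be a finite quiver with vertex set $Q_0$; write $h(a)$ and $t(a)$ for the head and tail of an arrow $a$, and compose paths from right to left, so that $pq$ is defined when $t(p)=h(q)$. Suppose that $Q$ is biserial, meaning that every vertex is the head of at most two arrows and the tail of at most two arrows. Let $Z$ be a set of paths of length at least $2$ in $Q$ such that $(Q,Z)$ is special, meaning that for every arrow $b$ there is at most one arrow $a$ with $t(a)=h(b)$ and $ab\notin Z$, and at most one arrow $c$ with $h(c)=t(b)$ and $bc\notin Z$. Let $B$ be the ideal of the path algebra $kQ$ generated by the arrows, let $\overline{kQ}=\varprojlim_d kQ/B^d$ be the completion of $kQ$ in the $B$-adic topology, and let $\overline{\langle Z\rangle}$ be the closure in $\overline{kQ}$ of the ideal $\langle Z\rangle$ of $kQ$, that is, the ideal of those $x\in\overline{kQ}$ such that for every $d$ the image of $x$ in $kQ/B^d$ is the image of an element of $\langle Z\rangle$. The quotient $\Gamma=\overline{kQ}/\overline{\langle Z\rangle}$ is called a completed string algebra. A path is $Z$-admissible if no element of $Z$ is a subpath of it. A cycle is a path of positive length with the same head and tail; a cycle is $Z$-primitive if all its powers are $Z$-admissible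 and it is not a power of a shorter cycle. Let $V(c)$ be the set of vertices traversed by a cycle $c$, let $V=\bigcup_c V(c)$ where $c$ runs through the $Z$-primitive cycles, and let $V=V[1]\sqcup\dots\sqcup V[n]$ be the partition of $V$ into the classes of the equivalence relation generated by $\bigcup_c V(c)\times V(c)$ (with the classes enumerated in any order). Let $e_v$ denote the trivial path at a vertex $v$, and let $\sigma_v$ be the (finite) sum of the $Z$-primitive cycles at $v$. Let $R=k[[t_1,\dots,t_n]]$ and let $I$ be the ideal $$I=\langle Z\rangle+\sum_{i=1}^{n}\Big(\langle t_ie_v-\sigma_v \mid v\in V[i]\rangle+\langle t_ie_v\mid v\in Q_0\setminus V[i]\rangle\Big)$$ of the path algebra $RQ$. Then $\Gamma$ and $RQ/I$ are isomorphic as $k$-algebras. -/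

import Mathlib

open Quiver

noncomputable section

namespace StringAlg

universe u v w

/-! ### Paths in a quiver

A path `a_n ⋯ a_1` with tail `x` and head `y` is a term of Mathlib's `Quiver.Path x y`.
Mathlib composes paths in the order of traversal, so the product `p q` of two paths, which is
written from right to left and which is defined when `t(p) = h(q)`, is `q.comp p`. -/

section Paths

variable {Q : Type u} [Quiver.{v} Q]

variable (Q) in
/-- The type of all paths of a quiver, packaged as (tail, head, path). -/
abbrev AnyPath : Type max u v := Σ x y : Q, Quiver.Path x y

/-- A quiver is biserial if every vertex is the head of at most two arrows and
the tail of at most two arrows. -/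
def IsBiserial (Q : Type u) [Quiver.{v} Q] : Prop :=
  ∀ x : Q, (ENat.card (Quiver.Costar x) ≤ 2) ∧ (ENat.card (Quiver.Star x) ≤ 2)

/-- The path `a b` of length two: first `b`, then `a`. -/
def twoPath {x y z : Q} (a : y ⟶ z) (b : x ⟶ y) : AnyPath Q :=
  ⟨x, z, b.toPath.comp a.toPath⟩

/-- `(Q, Z)` is special: for any arrow `b` there is at most one arrow `a` with `t(a) = h(b)` and
`a b ∉ Z`, and at most one arrow `c` with `h(c) = t(b)` and `b c ∉ Z`. -/
def IsSpecial (Z : Set (AnyPath Q)) : Prop :=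
  (∀ ⦃x y : Q⦄ (b : x ⟶ y), {a : Quiver.Star y | twoPath a.2 b ∉ Z}.Subsingleton) ∧
  (∀ ⦃x y : Q⦄ (b : x ⟶ y), {c : Quiver.Costar x | twoPath b c.2 ∉ Z}.Subsingleton)

/-- A path is `Z`-admissible if it has no subpath in `Z`. -/
def IsAdmissible (Z : Set (AnyPath Q)) {x y : Q} (p : Quiver.Path x y) : Prop :=
  ∀ (x' y' : Q) (q : Quiver.Path x x') (z : Quiver.Path x' y') (r : Quiver.Path y' y),
    p = (q.comp z).comp r → (⟨x', y', z⟩ : AnyPath Q) ∉ Z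

/-- The `m`-th power of a closed path. -/
def pathPow {x : Q} (c : Quiver.Path x x) : ℕ → Quiver.Path x x
  | 0 => Quiver.Path.nil
  | m + 1 => (pathPow c m).comp c

/-- A cycle (non-trivial closed path) is `Z`-primitive if all its powers are `Z`-admissible and it
is not a power of a shorter cycle. -/
def IsPrimitive (Z : Set (AnyPath Q)) {x : Q} (c : Quiver.Path x x) : Prop :=
  0 < c.length ∧ (∀ m : ℕ, 1 ≤ m → IsAdmissible Z (pathPow c m)) ∧
    ∀ d : Quiver.Path x x, 0 < d.length → d.length < c.length → ∀ m : ℕ, c ≠ pathPow d m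

/-- The set `V(p)` of the vertices traversed by a path `p`. -/
def traversed {x y : Q} (p : Quiver.Path x y) : Set Q :=
  {z | ∃ (q : Quiver.Path x z) (r : Quiver.Path z y), p = q.comp r}

/-- The set `V` of primitive vertices: those traversed by some `Z`-primitive cycle. -/
def primitiveVertices (Z : Set (AnyPath Q)) : Set Q :=
  {z | ∃ (x : Q) (c : Quiver.Path x x), IsPrimitive Z c ∧ z ∈ traversed c}

/-- The relation `⋃_c V(c) × V(c)` on `V`, where `c` runs through the `Z`-primitive cycles. -/
def nerveRel (Z : Set (AnyPath Q)) (y z : primitiveVertices Z) : Prop :=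
  ∃ (x : Q) (c : Quiver.Path x x), IsPrimitive Z c ∧ y.1 ∈ traversed c ∧ z.1 ∈ traversed c

/-- The set of parts of the primitive-nerve partition: the classes of the equivalence relation on
`V` generated by `nerveRel`. -/
def NerveParts (Z : Set (AnyPath Q)) : Type u :=
  Quotient (Relation.EqvGen.setoid (nerveRel Z))

instance [Finite Q] (Z : Set (AnyPath Q)) : Finite (NerveParts Z) :=
  inferInstanceAs (Finite (Quotient _))

/-- The part `V[i]`, as a set of vertices, for an enumeration `e` of the parts of the
primitive-nerve partition by a type `ι` of indices. -/
def part {Z : Set (AnyPath Q)} {ι : Type w} (e : ι ≃ NerveParts Z) (i : ι) : Set Q :=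
  {z | ∃ hz : z ∈ primitiveVertices Z,
    (Quotient.mk (Relation.EqvGen.setoid (nerveRel Z)) ⟨z, hz⟩ : NerveParts Z) = e i}

end Paths

/-! ### Path algebras -/

/-- The path algebra `R Q`: the free `R`-module on the paths of `Q`. -/
def PathAlgebra (R : Type w) [CommRing R] (Q : Type u) [Quiver.{v} Q] : Type max u v w :=
  AnyPath Q →₀ R

namespace PathAlgebra

variable (R : Type w) [CommRing R] {Q : Type u} [Quiver.{v} Q]

instance : AddCommGroup (PathAlgebra R Q) := inferInstanceAs (AddCommGroup (AnyPath Q →₀ R))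

instance {S : Type*} [CommSemiring S] [Algebra S R] : Module S (PathAlgebra R Q) :=
  inferInstanceAs (Module S (AnyPath Q →₀ R))

instance {S : Type*} [CommSemiring S] [Algebra S R] : IsScalarTower S R (PathAlgebra R Q) :=
  inferInstanceAs (IsScalarTower S R (AnyPath Q →₀ R))

variable (Q) in
/-- The `R`-basis of the path algebra given by the paths. -/
def basis : Module.Basis (AnyPath Q) R (PathAlgebra R Q) :=
  Module.Basis.ofRepr (LinearEquiv.refl R (AnyPath Q →₀ R))

/-- A path as an element of the path algebra. -/
def ofPath (p : AnyPath Q) : PathAlgebra R Q := basis R Q p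

/-- The trivial path `e_x` as an element of the path algebra. -/
def vertex (x : Q) : PathAlgebra R Q := ofPath R ⟨x, x, Quiver.Path.nil⟩

open Classical in
/-- The product `p q` of two paths in the path algebra: the composite path if `t(p) = h(q)`, and
zero otherwise. -/
def pathMul (p q : AnyPath Q) : PathAlgebra R Q :=
  if h : p.1 = q.2.1 then ofPath R ⟨q.1, p.2.1, q.2.2.comp (p.2.2.cast h rfl)⟩ else 0

/-- The `R`-bilinear extension of the product of paths. -/
def mulHom : PathAlgebra R Q →ₗ[R] PathAlgebra R Q →ₗ[R] PathAlgebra R Q :=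
  (basis R Q).constr R fun p => (basis R Q).constr R fun q => pathMul R p q

instance : Mul (PathAlgebra R Q) := ⟨fun x y => mulHom R x y⟩

/-- The identity of the path algebra is the sum of the trivial paths. -/
instance [Fintype Q] : One (PathAlgebra R Q) := ⟨∑ x : Q, vertex R x⟩

variable {R}

theorem mul_def (x y : PathAlgebra R Q) : x * y = mulHom R x y := rfl

theorem ofPath_mul_ofPath (p q : AnyPath Q) :
    (ofPath R p * ofPath R q : PathAlgebra R Q) = pathMul R p q := by
  rw [mul_def, mulHom, ofPath, ofPath, Module.Basis.constr_basis, Module.Basis.constr_basis]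

theorem ofPath_mul_ofPath_comp {x y z : Q} (p : Quiver.Path y z) (q : Quiver.Path x y) :
    (ofPath R ⟨y, z, p⟩ * ofPath R ⟨x, y, q⟩ : PathAlgebra R Q) = ofPath R ⟨x, z, q.comp p⟩ := by
  rw [ofPath_mul_ofPath]
  simp [pathMul]

theorem ofPath_mul_ofPath_of_ne {p q : AnyPath Q} (h : p.1 ≠ q.2.1) :
    (ofPath R p * ofPath R q : PathAlgebra R Q) = 0 := by
  rw [ofPath_mul_ofPath]
  simp [pathMul, h]

theorem induction_on {P : PathAlgebra R Q → Prop} (x : PathAlgebra R Q) (zero : P 0)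
    (add : ∀ x y, P x → P y → P (x + y)) (smul : ∀ (r : R) p, P (r • ofPath R p)) : P x := by
  rw [← (basis R Q).linearCombination_repr x, Finsupp.linearCombination_apply]
  exact Finset.sum_induction _ P add zero fun p _ => smul _ p

theorem path_mul_assoc (p q r : AnyPath Q) :
    (ofPath R p * ofPath R q * ofPath R r : PathAlgebra R Q)
      = ofPath R p * (ofPath R q * ofPath R r) := by
  have zero_mul' (x : PathAlgebra R Q) : 0 * x = 0 := by simp [mul_def]
  have mul_zero' (x : PathAlgebra R Q) : x * 0 = 0 := by simp [mul_def]
  obtain ⟨a, b, p⟩ := p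
  obtain ⟨c, d, q⟩ := q
  obtain ⟨e, f, r⟩ := r
  by_cases h₁ : a = d
  · subst h₁
    by_cases h₂ : c = f
    · subst h₂
      simp only [ofPath_mul_ofPath_comp, Quiver.Path.comp_assoc]
    · rw [ofPath_mul_ofPath_of_ne (p := ⟨c, a, q⟩) h₂, ofPath_mul_ofPath_comp,
        ofPath_mul_ofPath_of_ne h₂, mul_zero']
  · rw [ofPath_mul_ofPath_of_ne (p := ⟨a, b, p⟩) h₁, zero_mul']
    by_cases h₂ : c = f
    · subst h₂
      rw [ofPath_mul_ofPath_comp, ofPath_mul_ofPath_of_ne h₁]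
    · rw [ofPath_mul_ofPath_of_ne (p := ⟨c, d, q⟩) h₂, mul_zero']

instance [Fintype Q] : Ring (PathAlgebra R Q) where
  __ := (inferInstance : AddCommGroup (PathAlgebra R Q))
  left_distrib x y z := by simp [mul_def]
  right_distrib x y z := by simp [mul_def]
  zero_mul x := by simp [mul_def]
  mul_zero x := by simp [mul_def]
  mul_assoc x y z := by
    induction x using induction_on with
    | zero => simp [mul_def]
    | add a b ha hb => simp only [mul_def, map_add, LinearMap.add_apply] at *; rw [ha, hb]
    | smul a p =>
      induction y using induction_on with
      | zero => simp [mul_def]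
      | add c d hc hd => simp only [mul_def, map_add, LinearMap.add_apply] at *; rw [hc, hd]
      | smul c q =>
        induction z using induction_on with
        | zero => simp [mul_def]
        | add c d hc hd => simp only [mul_def, map_add] at *; rw [hc, hd]
        | smul e r =>
          have h := path_mul_assoc (R := R) p q r
          simp only [mul_def, map_smul, LinearMap.smul_apply] at *
          rw [h]
  one_mul x := by
    classical
    induction x using induction_on with
    | zero => simp [mul_def]
    | add a b ha hb => simp only [mul_def, map_add] at *; rw [ha, hb]
    | smul a p =>
      obtain ⟨b, c, p⟩ := p
      rw [mul_def, map_smul, ← mul_def]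
      congr 1
      change (∑ x : Q, vertex R x) * _ = _
      rw [mul_def, map_sum, LinearMap.sum_apply, Finset.sum_eq_single c]
      · rw [← mul_def]; exact ofPath_mul_ofPath_comp _ _
      · intro d _ hd
        rw [← mul_def]; exact ofPath_mul_ofPath_of_ne hd
      · simp
  mul_one x := by
    classical
    induction x using induction_on with
    | zero => simp [mul_def]
    | add a b ha hb => simp only [mul_def, map_add, LinearMap.add_apply] at *; rw [ha, hb]
    | smul a p =>
      obtain ⟨b, c, p⟩ := p
      rw [mul_def, map_smul, LinearMap.smul_apply, ← mul_def]
      congr 1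
      change _ * (∑ x : Q, vertex R x) = _
      rw [mul_def, map_sum, Finset.sum_eq_single b]
      · rw [← mul_def]
        refine (ofPath_mul_ofPath_comp _ _).trans ?_
        rw [Quiver.Path.nil_comp]
      · intro d _ hd
        rw [← mul_def]; exact ofPath_mul_ofPath_of_ne (Ne.symm hd)
      · simp

instance [Fintype Q] {S : Type*} [CommSemiring S] [Algebra S R] : Algebra S (PathAlgebra R Q) :=
  Algebra.ofModule
    (fun s x y => by
      rw [← algebraMap_smul R s x, ← algebraMap_smul R s (x * y), mul_def, mul_def, map_smul,
        LinearMap.smul_apply])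
    (fun s x y => by
      rw [← algebraMap_smul R s y, ← algebraMap_smul R s (x * y), mul_def, mul_def, map_smul])

end PathAlgebra

/-! ### Completions -/

section Completion

variable (k : Type w) [CommRing k] {A : Type u} [Ring A] [Algebra k A]

/-- The completion of a (possibly non-commutative) `k`-algebra `A` in the `B`-adic topology, for a
two-sided ideal `B`: the inverse limit of the quotients `A / B ^ d`, as the subalgebra of compatible
families in their product. -/
def Completion (B : Ideal A) [B.IsTwoSided] : Subalgebra k (∀ d : ℕ, A ⧸ B ^ d) where
  carrier := {x | ∀ ⦃d d' : ℕ⦄ (h : d ≤ d'),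
    Ideal.Quotient.factorₐ k (Ideal.pow_le_pow_right (I := B) h) (x d') = x d}
  mul_mem' hx hy d d' h := by simp only [Pi.mul_apply, map_mul, hx h, hy h]
  add_mem' hx hy d d' h := by simp only [Pi.add_apply, map_add, hx h, hy h]
  algebraMap_mem' r d d' h := by simp only [Pi.algebraMap_apply, AlgHom.commutes]

/-- The closure of (the image of) a two-sided ideal `H` of `A` in the `B`-adic completion of `A`,
that is, `⋂_d (H + B ^ d)` formed in the completion: an element of the completion belongs to it iff
for each `d` it is congruent to an element of `H` modulo the kernel of the projection of the
completion to `A / B ^ d`. -/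
def closureIdeal (B H : Ideal A) [B.IsTwoSided] [H.IsTwoSided] : Ideal (Completion k B) where
  carrier := {x | ∀ d : ℕ, ∃ h ∈ H, x.1 d = Ideal.Quotient.mk (B ^ d) h}
  zero_mem' d := ⟨0, H.zero_mem, by simp⟩
  add_mem' {x y} hx hy d := by
    obtain ⟨a, ha, hxa⟩ := hx d
    obtain ⟨b, hb, hyb⟩ := hy d
    exact ⟨a + b, H.add_mem ha hb, by simp [hxa, hyb]⟩
  smul_mem' c x hx d := by
    obtain ⟨a, ha, hxa⟩ := hx d
    obtain ⟨b, hb⟩ := Ideal.Quotient.mk_surjective (c.1 d)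
    exact ⟨b * a, H.mul_mem_left b ha, by simp [hxa, hb]⟩

instance (B H : Ideal A) [B.IsTwoSided] [H.IsTwoSided] : (closureIdeal k B H).IsTwoSided where
  mul_mem_of_left {x} c hx d := by
    obtain ⟨a, ha, hxa⟩ := hx d
    obtain ⟨b, hb⟩ := Ideal.Quotient.mk_surjective (c.1 d)
    exact ⟨a * b, H.mul_mem_right b ha, by simp [hxa, hb]⟩

end Completion

/-! ### The two algebras -/

section Main

variable {Q : Type u} [Quiver.{v} Q] [Fintype Q]

/-- The two-sided ideal of `R Q` generated by the arrows. -/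
def arrowIdeal (R : Type w) [CommRing R] (Q : Type u) [Quiver.{v} Q] [Fintype Q] :
    TwoSidedIdeal (PathAlgebra R Q) :=
  TwoSidedIdeal.span {a | ∃ (x y : Q) (f : x ⟶ y), a = PathAlgebra.ofPath R ⟨x, y, f.toPath⟩}

/-- The two-sided ideal `⟨Z⟩` of `R Q` generated by a set `Z` of paths. -/
def relationIdeal (R : Type w) [CommRing R] (Z : Set (AnyPath Q)) :
    TwoSidedIdeal (PathAlgebra R Q) :=
  TwoSidedIdeal.span (PathAlgebra.ofPath R '' Z)

/-- The completed string algebra of `(Q, Z)` over `k`: the quotient of the completion of `k Q` in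
the arrow-adic topology by the closure of the ideal generated by `Z`. -/
abbrev CompletedStringAlgebra (k : Type w) [Field k] (Z : Set (AnyPath Q)) : Type max u v w :=
  Completion k (arrowIdeal k Q).asIdeal ⧸
    closureIdeal k (arrowIdeal k Q).asIdeal (relationIdeal k Z).asIdeal

/-- The element `σ_x` of `R Q`: the sum of the `Z`-primitive cycles at `x`. There are finitely many
of them when `Q` is finite and `(Q, Z)` is special. -/
def sigma (R : Type w) [CommRing R] (Z : Set (AnyPath Q)) (x : Q) : PathAlgebra R Q :=
  ∑ᶠ c ∈ {c : Quiver.Path x x | IsPrimitive Z c}, PathAlgebra.ofPath R ⟨x, x, c⟩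

/-- The ideal
`I = ⟨Z⟩ + ∑ i, (⟨s_i e_x - σ_x ∣ x ∈ V[i]⟩ + ⟨s_i e_x ∣ x ∈ Q₀ ∖ V[i]⟩)` of `R Q`. -/
def stringIdeal {R : Type w} [CommRing R] (Z : Set (AnyPath Q)) {n : ℕ}
    (e : Fin n ≃ NerveParts Z) (s : Fin n → R) : TwoSidedIdeal (PathAlgebra R Q) :=
  relationIdeal R Z ⊔ ⨆ i : Fin n,
    (TwoSidedIdeal.span {a | ∃ x ∈ part e i, a = s i • PathAlgebra.vertex R x - sigma R Z x} ⊔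
      TwoSidedIdeal.span {a | ∃ x ∉ part e i, a = s i • PathAlgebra.vertex R x})

end Main

end StringAlg

end

noncomputable section

namespace StringAlg

universe u v w

/-!
Both algebras map to `∏ d, k Q / (⟨Z⟩ + B ^ d)`: the completed path algebra in the obvious way, with
kernel the closure of `⟨Z⟩`, and `R Q` by sending `t_i` to `∑_{v ∈ V[i]} σ_v`, which lies in `B` and
is central modulo `⟨Z⟩`. These homomorphisms have the same range, and the second has kernel `I`, for
the following reasons.

As `(Q, Z)` is special, an admissible path is determined by its last arrow and its length, so every
admissible path arises from one of finitely many reduced paths by extending it along a primitive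
cycle. Modulo `⟨Z⟩`, multiplication by `∑_{v ∈ V[i]} σ_v` is this extension, and `I` is generated by
`Z` and the elements `t_i - ∑_{v ∈ V[i]} σ_v`. Therefore every element of `R Q` is congruent modulo
`I` to a normal form `∑_p f_p p`, where `p` runs through the reduced paths and the monomials of
`f_p` act on `p` by extension. Its image is that of a formal sum of admissible paths in the
completed path algebra, and this image determines the formal sum.
-/

section Paths

variable {Q : Type u} [Quiver.{v} Q] {Z : Set (AnyPath Q)}

/-- The last arrow of a path, if there is one. -/
def lastArrow {x : Q} : ∀ {y : Q}, Quiver.Path x y → Option (Quiver.Costar y)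
  | _, .nil => none
  | _, .cons _ b => some ⟨_, b⟩

@[simp] theorem lastArrow_nil (x : Q) : lastArrow (.nil : Quiver.Path x x) = none := rfl

@[simp] theorem lastArrow_cons {x y z : Q} (p : Quiver.Path x y) (b : y ⟶ z) :
    lastArrow (p.cons b) = some ⟨y, b⟩ := rfl

theorem lastArrow_comp {x y z : Q} (p : Quiver.Path x y) {q : Quiver.Path y z}
    (hq : 0 < q.length) : lastArrow (p.comp q) = lastArrow q := by
  cases q with
  | nil => simp at hq
  | cons q b => rfl

theorem length_pos_of_lastArrow_eq_some {x y : Q} {p : Quiver.Path x y} {b : Quiver.Costar y}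
    (h : lastArrow p = some b) : 0 < p.length := by
  cases p with
  | nil => simp at h
  | cons q b => simp

theorem exists_lastArrow_eq_some {x y : Q} {p : Quiver.Path x y} (h : 0 < p.length) :
    ∃ b, lastArrow p = some b := by
  cases p with
  | nil => simp at h
  | cons q b => exact ⟨_, rfl⟩

theorem length_pos_of_lastArrow_eq {x x' y : Q} {p : Quiver.Path x y} {p' : Quiver.Path x' y}
    (h : lastArrow p = lastArrow p') (hp : 0 < p.length) : 0 < p'.length := by
  obtain ⟨b, hb⟩ := exists_lastArrow_eq_some hp
  exact length_pos_of_lastArrow_eq_some (h ▸ hb)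

theorem exists_eq_cons_of_lastArrow_eq_some {x y z : Q} {p : Quiver.Path x y} {b : z ⟶ y}
    (h : lastArrow p = some ⟨z, b⟩) : ∃ q : Quiver.Path x z, p = q.cons b := by
  cases p with
  | nil => simp at h
  | cons q b => cases h; exact ⟨q, rfl⟩

theorem exists_eq_comp_length_right {x y : Q} (p : Quiver.Path x y) {n : ℕ} (h : n ≤ p.length) :
    ∃ (z : Q) (q : Quiver.Path x z) (r : Quiver.Path z y), p = q.comp r ∧ r.length = n := by
  obtain ⟨z, q, r, rfl, hq⟩ := p.exists_eq_comp_of_le_length (n := p.length - n) (by omega)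
  rw [Quiver.Path.length_comp] at h hq
  exact ⟨z, q, r, rfl, by omega⟩

theorem comp_eq_comp_of_length_eq {x y z z' : Q} {p : Quiver.Path x z} {q : Quiver.Path z y}
    {p' : Quiver.Path x z'} {q' : Quiver.Path z' y} (h : p.comp q = p'.comp q')
    (hl : q.length = q'.length) :
    (⟨z, p, q⟩ : Σ z : Q, Quiver.Path x z × Quiver.Path z y) = ⟨z', p', q'⟩ := by
  induction q with
  | nil =>
    cases q' with
    | nil => simpa using h
    | cons => simp at hl
  | cons q b ih =>
    cases q' with
    | nil => simp at hl
    | cons q' b' =>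
      simp only [Quiver.Path.comp_cons, Quiver.Path.cons.injEq] at h
      obtain ⟨rfl, h, hb⟩ := h
      cases ih (eq_of_heq h) (by simpa using hl)
      cases hb
      rfl

/-! ### Powers of closed paths -/

@[simp] theorem pathPow_zero {x : Q} (c : Quiver.Path x x) : pathPow c 0 = .nil := rfl

theorem pathPow_succ {x : Q} (c : Quiver.Path x x) (m : ℕ) :
    pathPow c (m + 1) = (pathPow c m).comp c := rfl

@[simp] theorem pathPow_one {x : Q} (c : Quiver.Path x x) : pathPow c 1 = c := by
  simp [pathPow_succ]

@[simp] theorem pathPow_nil {x : Q} (m : ℕ) :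
    pathPow (.nil : Quiver.Path x x) m = .nil := by
  induction m with
  | zero => rfl
  | succ m ih => rw [pathPow_succ, ih, Quiver.Path.nil_comp]

theorem pathPow_add {x : Q} (c : Quiver.Path x x) (m n : ℕ) :
    pathPow c (m + n) = (pathPow c m).comp (pathPow c n) := by
  induction n with
  | zero => rfl
  | succ n ih => rw [← add_assoc, pathPow_succ, ih, pathPow_succ, Quiver.Path.comp_assoc]

theorem pathPow_succ' {x : Q} (c : Quiver.Path x x) (m : ℕ) :
    pathPow c (m + 1) = c.comp (pathPow c m) := by
  rw [add_comm, pathPow_add, pathPow_one]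

theorem pathPow_mul {x : Q} (c : Quiver.Path x x) (m n : ℕ) :
    pathPow c (m * n) = pathPow (pathPow c m) n := by
  induction n with
  | zero => rfl
  | succ n ih => rw [mul_add, mul_one, pathPow_add, ih, pathPow_succ]

@[simp] theorem length_pathPow {x : Q} (c : Quiver.Path x x) (m : ℕ) :
    (pathPow c m).length = m * c.length := by
  induction m with
  | zero => simp
  | succ m ih => rw [pathPow_succ, Quiver.Path.length_comp, ih, Nat.succ_mul]

theorem lastArrow_comp_pathPow {x y : Q} {p : Quiver.Path x y} {c : Quiver.Path y y}
    (hl : lastArrow p = lastArrow c) (m : ℕ) :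
    lastArrow (p.comp (pathPow c m)) = lastArrow p := by
  cases c with
  | nil => simp
  | cons c b =>
    cases m with
    | zero => simp
    | succ m => rw [pathPow_succ, ← Quiver.Path.comp_assoc, lastArrow_comp _ (by simp), hl]

theorem lastArrow_pathPow_succ {x : Q} (c : Quiver.Path x x) (m : ℕ) :
    lastArrow (pathPow c (m + 1)) = lastArrow c := by
  rw [pathPow_succ', lastArrow_comp_pathPow rfl]

theorem toPath_comp_pathPow {x y : Q} (a : x ⟶ y) (c : Quiver.Path y x) (m : ℕ) :
    a.toPath.comp (pathPow (c.cons a) m) = (pathPow (a.toPath.comp c) m).comp a.toPath := by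
  induction m with
  | zero => rw [pathPow_zero, pathPow_zero, Quiver.Path.comp_nil, Quiver.Path.nil_comp]
  | succ m ih =>
    rw [pathPow_succ, ← Quiver.Path.comp_assoc, ih, pathPow_succ, ← Quiver.Path.comp_toPath_eq_cons]
    simp only [Quiver.Path.comp_assoc]

/-! ### Admissible paths in a special pair -/

theorem IsAdmissible.of_comp_left {x y z : Q} {p : Quiver.Path x y} {q : Quiver.Path y z}
    (h : IsAdmissible Z (p.comp q)) : IsAdmissible Z p := by
  rintro x' y' p' s r rfl
  exact h x' y' p' s (r.comp q) (by simp only [Quiver.Path.comp_assoc])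

theorem IsAdmissible.of_comp_right {x y z : Q} {p : Quiver.Path x y} {q : Quiver.Path y z}
    (h : IsAdmissible Z (p.comp q)) : IsAdmissible Z q := by
  rintro x' y' p' s r rfl
  exact h x' y' (p.comp p') s r (by simp only [Quiver.Path.comp_assoc])

theorem IsAdmissible.twoPath_notMem {x y z t s : Q} {p : Quiver.Path x y} {c : y ⟶ z} {b : z ⟶ t}
    {q : Quiver.Path t s} (h : IsAdmissible Z ((p.cons c).comp (b.toPath.comp q))) :
    twoPath b c ∉ Z :=
  h _ _ p _ q (by simp only [← Quiver.Path.comp_toPath_eq_cons, Quiver.Path.comp_assoc])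

theorem lastArrow_eq_of_isAdmissible_comp (hZ : IsSpecial Z) {x x' y z : Q} {p : Quiver.Path x y}
    {p' : Quiver.Path x' y} {q : Quiver.Path y z} (h : IsAdmissible Z (p.comp q))
    (h' : IsAdmissible Z (p'.comp q)) (hp : 0 < p.length) (hp' : 0 < p'.length)
    (hq : 0 < q.length) : lastArrow p = lastArrow p' := by
  obtain ⟨_, p, b, rfl⟩ := Quiver.Path.length_ne_zero_iff_eq_cons p |>.mp hp.ne'
  obtain ⟨_, p', b', rfl⟩ := Quiver.Path.length_ne_zero_iff_eq_cons p' |>.mp hp'.ne'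
  obtain ⟨_, a, q, rfl, -⟩ := q.length_ne_zero_iff_eq_comp.mp hq.ne'
  simpa using @hZ.2 _ _ a ⟨_, b⟩ h.twoPath_notMem ⟨_, b'⟩ h'.twoPath_notMem

theorem IsAdmissible.eq_of_lastArrow_eq (hZ : IsSpecial Z) {x x' y : Q} {p : Quiver.Path x y}
    {p' : Quiver.Path x' y} (h : IsAdmissible Z p) (h' : IsAdmissible Z p')
    (hl : lastArrow p = lastArrow p') (hn : p.length = p'.length) :
    (⟨x, p⟩ : Σ x : Q, Quiver.Path x y) = ⟨x', p'⟩ := by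
  induction p with
  | nil =>
    cases p' with
    | nil => rfl
    | cons => simp at hn
  | cons p b ih =>
    obtain ⟨p', rfl⟩ := exists_eq_cons_of_lastArrow_eq_some hl.symm
    simp only [Quiver.Path.length_cons, add_left_inj] at hn
    have hpp : lastArrow p = lastArrow p' := by
      rcases Nat.eq_zero_or_pos p.length with h0 | h0
      · cases p with
        | cons => simp at h0
        | nil =>
          cases p' with
          | cons => simp at hn
          | nil => rfl
      · exact lastArrow_eq_of_isAdmissible_comp hZ (q := b.toPath) h h' h0 (hn ▸ h0) (by simp)
    cases ih (h.of_comp_left (q := b.toPath)) (h'.of_comp_left (q := b.toPath)) hpp hn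
    rfl

theorem IsAdmissible.exists_eq_comp_of_lastArrow_eq (hZ : IsSpecial Z) {x x' y : Q}
    {p : Quiver.Path x y} {p' : Quiver.Path x' y} (h : IsAdmissible Z p) (h' : IsAdmissible Z p')
    (hl : lastArrow p = lastArrow p') (hn : p.length ≤ p'.length) :
    ∃ r : Quiver.Path x' x, p' = r.comp p := by
  obtain ⟨z, q, r, rfl, hr⟩ := exists_eq_comp_length_right p' hn
  suffices hlr : lastArrow p = lastArrow r by
    cases h.eq_of_lastArrow_eq hZ h'.of_comp_right hlr hr.symm
    exact ⟨q, rfl⟩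
  rcases Nat.eq_zero_or_pos r.length with h0 | h0
  · cases r with
    | cons => simp at h0
    | nil =>
      cases p with
      | cons => simp at hr
      | nil => rfl
  · rw [hl, lastArrow_comp _ h0]

theorem IsAdmissible.exists_eq_comp_of_toPath_comp (hZ : IsSpecial Z) {x y z z' : Q} {a : x ⟶ y}
    {s : Quiver.Path y z} {s' : Quiver.Path y z'} (h : IsAdmissible Z (a.toPath.comp s))
    (h' : IsAdmissible Z (a.toPath.comp s')) (hn : s.length ≤ s'.length) :
    ∃ r : Quiver.Path z z', s' = s.comp r := by
  induction hN : s.length generalizing x y with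
  | zero =>
    cases s with
    | nil => exact ⟨s', s'.nil_comp.symm⟩
    | cons => simp at hN
  | succ N ih =>
    obtain ⟨_, a₁, s, rfl, hs⟩ := s.length_ne_zero_iff_eq_comp.mp (by omega)
    obtain ⟨_, a₂, s', rfl, hs'⟩ := s'.length_ne_zero_iff_eq_comp.mp (by omega)
    have h₁ : IsAdmissible Z ((Quiver.Path.nil.cons a).comp (a₁.toPath.comp s)) := h
    have h₂ : IsAdmissible Z ((Quiver.Path.nil.cons a).comp (a₂.toPath.comp s')) := h'
    cases @hZ.1 _ _ a ⟨_, a₁⟩ h₁.twoPath_notMem ⟨_, a₂⟩ h₂.twoPath_notMem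
    obtain ⟨r, rfl⟩ := ih h.of_comp_right h'.of_comp_right (by omega) (by omega)
    exact ⟨r, (Quiver.Path.comp_assoc _ _ _).symm⟩

/-! ### Periods -/

/-- A cycle all of whose powers are admissible; the primitive cycles are the periods that are not
powers of shorter ones. -/
def IsPeriod (Z : Set (AnyPath Q)) {x : Q} (c : Quiver.Path x x) : Prop :=
  0 < c.length ∧ ∀ m : ℕ, IsAdmissible Z (pathPow c m)

theorem IsPrimitive.isPeriod {x : Q} {c : Quiver.Path x x} (h : IsPrimitive Z c) :
    IsPeriod Z c :=
  ⟨h.1, fun m => (h.2.1 (m + 1) (by omega)).of_comp_left⟩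

namespace IsPeriod

theorem isAdmissible {x : Q} {c : Quiver.Path x x} (h : IsPeriod Z c) : IsAdmissible Z c := by
  simpa using h.2 1

theorem isAdmissible_comp_self {x : Q} {c : Quiver.Path x x} (h : IsPeriod Z c) :
    IsAdmissible Z (c.comp c) := by
  simpa [pathPow_succ] using h.2 2

theorem isAdmissible_comp (hZ : IsSpecial Z) {x y : Q} {p : Quiver.Path x y} {c : Quiver.Path y y}
    (hc : IsPeriod Z c) (hp : IsAdmissible Z p) (hl : lastArrow p = lastArrow c) :
    IsAdmissible Z (p.comp c) := by
  obtain ⟨r, hr⟩ := hp.exists_eq_comp_of_lastArrow_eq hZ (hc.2 (p.length + 1))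
    (by rw [lastArrow_pathPow_succ, hl]) (by rw [length_pathPow]; nlinarith [hc.1])
  have h := hc.2 (p.length + 1 + 1)
  rw [pathPow_succ, hr, Quiver.Path.comp_assoc] at h
  exact h.of_comp_right

theorem isAdmissible_comp_pathPow (hZ : IsSpecial Z) {x y : Q} {p : Quiver.Path x y}
    {c : Quiver.Path y y} (hc : IsPeriod Z c) (hp : IsAdmissible Z p)
    (hl : lastArrow p = lastArrow c) (m : ℕ) : IsAdmissible Z (p.comp (pathPow c m)) := by
  induction m with
  | zero => simpa
  | succ m ih =>
    rw [pathPow_succ, ← Quiver.Path.comp_assoc]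
    exact hc.isAdmissible_comp hZ ih (by rw [lastArrow_comp_pathPow hl, hl])

theorem lastArrow_eq (hZ : IsSpecial Z) {x y : Q} {p : Quiver.Path x y} {c : Quiver.Path y y}
    (hc : IsPeriod Z c) (h : IsAdmissible Z (p.comp c)) (hp : 0 < p.length) :
    lastArrow p = lastArrow c :=
  lastArrow_eq_of_isAdmissible_comp hZ h hc.isAdmissible_comp_self hp hc.1 hc.1

theorem of_comp_left (hZ : IsSpecial Z) {x : Q} {r c : Quiver.Path x x} (hc : IsPeriod Z c)
    (hrc : IsPeriod Z (r.comp c)) (hr : 0 < r.length) : IsPeriod Z r := by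
  refine ⟨hr, fun m => ?_⟩
  induction m with
  | zero => exact hc.2 0
  | succ m ih =>
    suffices h : IsAdmissible Z (((pathPow r m).comp r).comp c) from h.of_comp_left
    rw [Quiver.Path.comp_assoc]
    cases m with
    | zero => simpa using hrc.isAdmissible
    | succ m =>
      refine hrc.isAdmissible_comp hZ ih ?_
      rw [lastArrow_pathPow_succ, lastArrow_comp _ hc.1, hc.lastArrow_eq hZ hrc.isAdmissible hr]

theorem of_pathPow {x : Q} {c : Quiver.Path x x} {m : ℕ} (h : IsPeriod Z (pathPow c m)) :
    IsPeriod Z c := by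
  have hpos : 0 < m * c.length := length_pathPow c m ▸ h.1
  have hm : 0 < m := Nat.pos_of_mul_pos_right hpos
  refine ⟨Nat.pos_of_mul_pos_left hpos, fun i => ?_⟩
  have hi := h.2 i
  rw [← pathPow_mul, ← Nat.add_sub_cancel' (Nat.le_mul_of_pos_left i hm), pathPow_add] at hi
  exact hi.of_comp_left

theorem exists_common_root (hZ : IsSpecial Z) {y : Q} {c d : Quiver.Path y y}
    (hc : IsPeriod Z c) (hd : IsPeriod Z d) (hl : lastArrow c = lastArrow d) :
    ∃ (r : Quiver.Path y y) (i j : ℕ), c = pathPow r i ∧ d = pathPow r j := by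
  induction hN : c.length + d.length using Nat.strong_induction_on generalizing c d with
  | _ N ih =>
    wlog hcd : c.length ≤ d.length generalizing c d
    · obtain ⟨r, i, j, hri, hrj⟩ := this hd hc hl.symm (by omega) (by omega)
      exact ⟨r, j, i, hrj, hri⟩
    obtain ⟨r, rfl⟩ := hc.isAdmissible.exists_eq_comp_of_lastArrow_eq hZ hd.isAdmissible hl hcd
    rcases Nat.eq_zero_or_pos r.length with hr | hr
    · exact ⟨c, 1, 1, by simp, by simp [Quiver.Path.eq_nil_of_length_zero r hr]⟩
    have hc0 := hc.1
    rw [Quiver.Path.length_comp] at hN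
    obtain ⟨s, i, j, hri, hcj⟩ := ih (r.length + c.length) (by omega) (hc.of_comp_left hZ hd hr) hc
      (hc.lastArrow_eq hZ hd.isAdmissible hr) rfl
    exact ⟨s, j, i + j, hcj, by rw [pathPow_add, ← hri, ← hcj]⟩

theorem exists_isPrimitive {y : Q} {c : Quiver.Path y y} (hc : IsPeriod Z c) :
    ∃ d : Quiver.Path y y, IsPrimitive Z d ∧ lastArrow d = lastArrow c := by
  induction hN : c.length using Nat.strong_induction_on generalizing c with
  | _ N ih =>
    by_cases hp : IsPrimitive Z c
    · exact ⟨c, hp, rfl⟩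
    have hroot : ∃ d : Quiver.Path y y, d.length < c.length ∧ ∃ m : ℕ, c = pathPow d m := by
      by_contra! hcon
      exact hp ⟨hc.1, fun m _ => hc.2 m, fun d _ => hcon d⟩
    obtain ⟨d, hdc, m, rfl⟩ := hroot
    obtain ⟨e, he, hl⟩ := ih d.length (hN ▸ hdc) hc.of_pathPow rfl
    cases m with
    | zero => simp at hdc
    | succ m => exact ⟨e, he, by rw [hl, lastArrow_pathPow_succ]⟩

end IsPeriod

namespace IsPrimitive

theorem eq_of_eq_pathPow {y : Q} {c r : Quiver.Path y y} (hc : IsPrimitive Z c) {i : ℕ}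
    (h : c = pathPow r i) : c = r := by
  rcases i with _ | _ | i
  · simpa [h] using hc.1
  · simpa using h
  · have hl : c.length = (i + 2) * r.length := by rw [h, length_pathPow]
    have hc0 := hc.1
    exact absurd h (hc.2.2 r (by nlinarith) (by nlinarith) _)

theorem eq_of_lastArrow_eq (hZ : IsSpecial Z) {y : Q} {c d : Quiver.Path y y}
    (hc : IsPrimitive Z c) (hd : IsPrimitive Z d) (hl : lastArrow c = lastArrow d) : c = d := by
  obtain ⟨r, i, j, hci, hdj⟩ := hc.isPeriod.exists_common_root hZ hd.isPeriod hl
  rw [hc.eq_of_eq_pathPow hci, hd.eq_of_eq_pathPow hdj]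

theorem rotate {x y : Q} {a : x ⟶ y} {c : Quiver.Path y x} (h : IsPrimitive Z (c.cons a)) :
    IsPrimitive Z (a.toPath.comp c) := by
  refine ⟨by simp [Quiver.Path.length_comp], fun m _ => ?_, fun d hd hdc m hm => ?_⟩
  · have hpow : pathPow (c.cons a) (m + 1)
        = (c.comp (pathPow (a.toPath.comp c) m)).comp a.toPath := by
      rw [pathPow_succ', Quiver.Path.comp_assoc, ← toPath_comp_pathPow, ← Quiver.Path.comp_assoc]
      rfl
    have hadm := h.2.1 (m + 1) (by omega)
    rw [hpow] at hadm
    exact hadm.of_comp_left.of_comp_right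
  · obtain ⟨z, a', d, rfl, -⟩ := d.length_ne_zero_iff_eq_comp.mp hd.ne'
    obtain ⟨m, rfl⟩ : ∃ i, m = i + 1 := Nat.exists_eq_succ_of_ne_zero (by
      rintro rfl
      simpa [Quiver.Path.length_comp] using congrArg Quiver.Path.length hm)
    have hm' := hm
    rw [pathPow_succ', Quiver.Path.comp_assoc] at hm'
    have hlen := congrArg Quiver.Path.length hm'
    simp only [Quiver.Path.length_comp, Quiver.Path.length_toPath] at hlen hdc
    cases comp_eq_comp_of_length_eq hm' (by rw [Quiver.Path.length_comp]; omega)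
    refine h.2.2 (d.cons a) (by simp) (by simpa [add_comm] using hdc) (m + 1) ?_
    apply Quiver.Path.comp_injective_right a.toPath
    rw [toPath_comp_pathPow, ← hm, Quiver.Path.comp_assoc]
    rfl

end IsPrimitive

/-! ### Existence of primitive cycles -/

/-- There are arbitrarily long admissible paths with last arrow `b`. -/
def HasLongPaths (Z : Set (AnyPath Q)) {y : Q} (b : Quiver.Costar y) : Prop :=
  ∀ n : ℕ, ∃ (z : Q) (p : Quiver.Path z y), IsAdmissible Z p ∧ lastArrow p = some b ∧ n ≤ p.length

namespace HasLongPaths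

theorem exists_eq_comp (hZ : IsSpecial Z) {x y : Q} {b : Quiver.Costar y} (h : HasLongPaths Z b)
    {q : Quiver.Path x y} (hq : IsAdmissible Z q) (hl : lastArrow q = some b) (n : ℕ) :
    ∃ (z : Q) (r : Quiver.Path z x), n ≤ r.length ∧ IsAdmissible Z (r.comp q) := by
  obtain ⟨z, p, hp, hpl, hn⟩ := h (n + q.length)
  obtain ⟨r, rfl⟩ := hq.exists_eq_comp_of_lastArrow_eq hZ hp (hl.trans hpl.symm) (by omega)
  rw [Quiver.Path.length_comp] at hn
  exact ⟨z, r, by omega, hp⟩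

theorem isPeriod (hZ : IsSpecial Z) {x y : Q} {b : x ⟶ y} (h : HasLongPaths Z ⟨x, b⟩)
    {c : Quiver.Path y y} (hc : IsAdmissible Z (b.toPath.comp c))
    (hl : lastArrow c = some ⟨x, b⟩) : IsPeriod Z c := by
  have hc0 := length_pos_of_lastArrow_eq_some hl
  suffices hb : ∀ m, IsAdmissible Z (b.toPath.comp (pathPow c m)) from
    ⟨hc0, fun m => (hb m).of_comp_right⟩
  intro m
  induction m with
  | zero => exact hc.of_comp_left
  | succ m ih =>
    -- Long paths ending in `b c` have an initial part ending in `b`, hence in `b c ^ m`.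
    obtain ⟨z, r, hr, hrc⟩ := h.exists_eq_comp hZ hc (by rw [lastArrow_comp _ hc0, hl])
      (pathPow c m).length
    rw [← Quiver.Path.comp_assoc] at hrc
    obtain ⟨s, hs⟩ := ih.exists_eq_comp_of_lastArrow_eq hZ hrc.of_comp_left
      (lastArrow_comp_pathPow (p := b.toPath) hl.symm m)
      (by simp only [Quiver.Path.length_comp]; omega)
    rw [hs, Quiver.Path.comp_assoc, Quiver.Path.comp_assoc, ← pathPow_succ] at hrc
    exact hrc.of_comp_right

theorem exists_isAdmissible_toPath_comp [Finite Q] [∀ x y : Q, Finite (x ⟶ y)] (hZ : IsSpecial Z)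
    {x y : Q} {b : x ⟶ y} (h : HasLongPaths Z ⟨x, b⟩) :
    ∃ c : Quiver.Path y y, IsAdmissible Z (b.toPath.comp c) ∧ lastArrow c = some ⟨x, b⟩ := by
  have hfirst (n : ℕ) : ∃ (a : Σ z w : Q, z ⟶ w) (s : Quiver.Path a.2.1 y), s.length = n ∧
      IsAdmissible Z (a.2.2.toPath.comp s) ∧ lastArrow (a.2.2.toPath.comp s) = some ⟨x, b⟩ := by
    obtain ⟨z, p, hp, hpl, hn⟩ := h (n + 1)
    obtain ⟨w, q, r, rfl, hr⟩ := exists_eq_comp_length_right p hn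
    rw [lastArrow_comp _ (by omega)] at hpl
    obtain ⟨t, a, s, rfl, hs⟩ := r.length_ne_zero_iff_eq_comp.mp (by omega)
    exact ⟨⟨w, t, a⟩, s, by omega, hp.of_comp_right, hpl⟩
  choose a ha using hfirst
  obtain ⟨m, -, n, -, hmn, heq⟩ := Set.infinite_univ.exists_lt_map_eq_of_mapsTo
    (Set.mapsTo_univ a _) Set.finite_univ
  obtain ⟨s, hs, has, hasl⟩ := ha m
  obtain ⟨s', hs', has', hasl'⟩ := heq ▸ ha n
  obtain ⟨c, rfl⟩ := has.exists_eq_comp_of_toPath_comp hZ has' (by omega)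
  rw [Quiver.Path.length_comp] at hs'
  rw [← Quiver.Path.comp_assoc] at has' hasl'
  obtain ⟨q, hq⟩ := exists_eq_cons_of_lastArrow_eq_some hasl
  rw [hq, ← Quiver.Path.comp_toPath_eq_cons, Quiver.Path.comp_assoc] at has'
  exact ⟨c, has'.of_comp_right, by rwa [lastArrow_comp _ (by omega)] at hasl'⟩

theorem exists_isPrimitive [Finite Q] [∀ x y : Q, Finite (x ⟶ y)] (hZ : IsSpecial Z) {y : Q}
    {b : Quiver.Costar y} (h : HasLongPaths Z b) :
    ∃ c : Quiver.Path y y, IsPrimitive Z c ∧ lastArrow c = some b := by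
  obtain ⟨c, hc, hl⟩ := h.exists_isAdmissible_toPath_comp hZ
  obtain ⟨d, hd, hdl⟩ := (h.isPeriod hZ hc hl).exists_isPrimitive
  exact ⟨d, hd, hdl.trans hl⟩

end HasLongPaths

theorem finite_setOf_length_eq (Q : Type u) [Quiver.{v} Q] [Finite Q]
    [∀ x y : Q, Finite (x ⟶ y)] (n : ℕ) : {p : AnyPath Q | p.2.2.length = n}.Finite := by
  induction n with
  | zero =>
    refine (Set.finite_range fun x : Q => (⟨x, x, .nil⟩ : AnyPath Q)).subset ?_
    rintro ⟨x, y, p⟩ hp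
    cases p with
    | nil => exact ⟨x, rfl⟩
    | cons => simp at hp
  | succ n ih =>
    refine (ih.biUnion fun p _ => Set.finite_range fun b : Quiver.Star p.2.1 =>
      (⟨p.1, b.1, p.2.2.cons b.2⟩ : AnyPath Q)).subset ?_
    rintro ⟨x, y, p⟩ hp
    cases p with
    | nil => simp at hp
    | @cons z _ p b => exact Set.mem_biUnion (x := ⟨x, z, p⟩) (by simpa using hp) ⟨⟨y, b⟩, rfl⟩

theorem finite_setOf_length_lt (Q : Type u) [Quiver.{v} Q] [Finite Q]
    [∀ x y : Q, Finite (x ⟶ y)] (n : ℕ) : {p : AnyPath Q | p.2.2.length < n}.Finite := by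
  refine ((Set.finite_lt_nat n).biUnion fun i _ => finite_setOf_length_eq Q i).subset ?_
  exact fun p hp => Set.mem_biUnion hp rfl

/-! ### Reduced and periodic paths -/

/-- An admissible path is reduced if it is not a non-trivial path followed by a primitive cycle. -/
def IsReduced (Z : Set (AnyPath Q)) (p : AnyPath Q) : Prop :=
  IsAdmissible Z p.2.2 ∧ ∀ (q : Quiver.Path p.1 p.2.1) (c : Quiver.Path p.2.1 p.2.1),
    0 < q.length → IsPrimitive Z c → p.2.2 ≠ q.comp c

theorem isReduced_nil {x : Q} (h : IsAdmissible Z (.nil : Quiver.Path x x)) :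
    IsReduced Z ⟨x, x, .nil⟩ := by
  refine ⟨h, fun q c hq _ hqc => ?_⟩
  have hlen := congrArg Quiver.Path.length hqc
  rw [Quiver.Path.length_nil, Quiver.Path.length_comp] at hlen
  omega

theorem exists_length_lt_of_isReduced [Finite Q] [∀ x y : Q, Finite (x ⟶ y)] (hZ : IsSpecial Z)
    {y : Q} (b : Quiver.Costar y) : ∃ N : ℕ, ∀ (x : Q) (p : Quiver.Path x y),
      IsReduced Z ⟨x, y, p⟩ → lastArrow p = some b → p.length < N := by
  by_cases h : HasLongPaths Z b
  · obtain ⟨c, hc, hcl⟩ := h.exists_isPrimitive hZ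
    refine ⟨c.length + 1, fun x p hp hpl => ?_⟩
    by_contra! hlt
    obtain ⟨r, hr⟩ := hc.isPeriod.isAdmissible.exists_eq_comp_of_lastArrow_eq hZ hp.1
      (hcl.trans hpl.symm) (Nat.le_of_succ_le hlt)
    have hlen := congrArg Quiver.Path.length hr
    rw [Quiver.Path.length_comp] at hlen
    exact hp.2 r c (by dsimp only at hlen ⊢; omega) hc hr
  · unfold HasLongPaths at h
    push Not at h
    obtain ⟨N, hN⟩ := h
    exact ⟨N, fun x p hp hpl => hN x p hp.1 hpl⟩

theorem finite_setOf_isReduced [Finite Q] [∀ x y : Q, Finite (x ⟶ y)] (hZ : IsSpecial Z) :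
    {p : AnyPath Q | IsReduced Z p}.Finite := by
  choose N hN using fun b : Σ y : Q, Quiver.Costar y => exists_length_lt_of_isReduced hZ b.2
  refine ((finite_setOf_length_eq Q 0).union
    (Set.finite_iUnion fun b => finite_setOf_length_lt Q (N b))).subset ?_
  rintro ⟨x, y, p⟩ hp
  rcases Nat.eq_zero_or_pos p.length with h0 | h0
  · exact Or.inl h0
  · obtain ⟨b, hb⟩ := exists_lastArrow_eq_some h0
    exact Or.inr (Set.mem_iUnion.mpr ⟨⟨y, b⟩, hN ⟨y, b⟩ x p hp hb⟩)

/-- A path is periodic if its last arrow is the last arrow of a primitive cycle. -/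
def IsPeriodic (Z : Set (AnyPath Q)) (p : AnyPath Q) : Prop :=
  ∃ c : Quiver.Path p.2.1 p.2.1, IsPrimitive Z c ∧ lastArrow p.2.2 = lastArrow c

open Classical in
/-- The primitive cycle with the same last arrow as `p`, or the trivial path if there is none. -/
def cycleOf (Z : Set (AnyPath Q)) (p : AnyPath Q) : Quiver.Path p.2.1 p.2.1 :=
  if h : IsPeriodic Z p then h.choose else .nil

/-- The path `p` followed by the `m`-th power of the primitive cycle with the same last arrow; this
is `p` itself if there is no such cycle. -/
def extend (Z : Set (AnyPath Q)) (p : AnyPath Q) (m : ℕ) : AnyPath Q :=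
  ⟨p.1, p.2.1, p.2.2.comp (pathPow (cycleOf Z p) m)⟩

theorem IsPeriodic.isPrimitive {p : AnyPath Q} (h : IsPeriodic Z p) :
    IsPrimitive Z (cycleOf Z p) := by
  rw [cycleOf, dif_pos h]
  exact h.choose_spec.1

theorem IsPeriodic.lastArrow_eq {p : AnyPath Q} (h : IsPeriodic Z p) :
    lastArrow p.2.2 = lastArrow (cycleOf Z p) := by
  rw [cycleOf, dif_pos h]
  exact h.choose_spec.2

theorem IsPeriodic.length_pos {p : AnyPath Q} (h : IsPeriodic Z p) : 0 < p.2.2.length :=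
  length_pos_of_lastArrow_eq h.lastArrow_eq.symm h.isPrimitive.1

theorem cycleOf_of_not_isPeriodic {p : AnyPath Q} (h : ¬ IsPeriodic Z p) : cycleOf Z p = .nil :=
  dif_neg h

theorem cycleOf_eq (hZ : IsSpecial Z) {p : AnyPath Q} {c : Quiver.Path p.2.1 p.2.1}
    (hc : IsPrimitive Z c) (hl : lastArrow p.2.2 = lastArrow c) : cycleOf Z p = c := by
  have h : IsPeriodic Z p := ⟨c, hc, hl⟩
  exact h.isPrimitive.eq_of_lastArrow_eq hZ hc (h.lastArrow_eq.symm.trans hl)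

theorem cycleOf_eq_cycleOf {x x' y : Q} {p : Quiver.Path x y} {q : Quiver.Path x' y}
    (h : lastArrow p = lastArrow q) : cycleOf Z ⟨x, y, p⟩ = cycleOf Z ⟨x', y, q⟩ := by
  unfold cycleOf IsPeriodic
  dsimp only
  rw [h]

@[simp] theorem extend_zero (p : AnyPath Q) : extend Z p 0 = p := rfl

theorem extend_of_not_isPeriodic {p : AnyPath Q} (h : ¬ IsPeriodic Z p) (m : ℕ) :
    extend Z p m = p := by
  rw [extend, cycleOf, dif_neg h, pathPow_nil, Quiver.Path.comp_nil]

theorem length_extend (p : AnyPath Q) (m : ℕ) :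
    (extend Z p m).2.2.length = p.2.2.length + m * (cycleOf Z p).length := by
  simp [extend, Quiver.Path.length_comp]

theorem IsPeriodic.extend_injective {p : AnyPath Q} (h : IsPeriodic Z p) :
    Function.Injective (StringAlg.extend Z p) := by
  intro m n hmn
  have hlen := congrArg (fun p : AnyPath Q => p.2.2.length) hmn
  simp only [length_extend, add_right_inj] at hlen
  exact Nat.eq_of_mul_eq_mul_right h.isPrimitive.1 hlen

theorem lastArrow_extend (p : AnyPath Q) (m : ℕ) :
    lastArrow (extend Z p m).2.2 = lastArrow p.2.2 := by
  change lastArrow (p.2.2.comp (pathPow (cycleOf Z p) m)) = _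
  by_cases h : IsPeriodic Z p
  · exact lastArrow_comp_pathPow h.lastArrow_eq m
  · rw [cycleOf_of_not_isPeriodic h, pathPow_nil, Quiver.Path.comp_nil]

theorem extend_extend (p : AnyPath Q) (m n : ℕ) :
    extend Z (extend Z p m) n = extend Z p (m + n) := by
  have hcyc : cycleOf Z (extend Z p m) = cycleOf Z p := cycleOf_eq_cycleOf (lastArrow_extend p m)
  change (⟨p.1, p.2.1, _⟩ : AnyPath Q) = ⟨p.1, p.2.1, _⟩
  rw [hcyc, pathPow_add, ← Quiver.Path.comp_assoc]
  rfl

theorem isAdmissible_extend (hZ : IsSpecial Z) {p : AnyPath Q} (hp : IsAdmissible Z p.2.2)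
    (m : ℕ) : IsAdmissible Z (extend Z p m).2.2 := by
  by_cases h : IsPeriodic Z p
  · exact h.isPrimitive.isPeriod.isAdmissible_comp_pathPow hZ hp h.lastArrow_eq m
  · rwa [extend_of_not_isPeriodic h]

theorem exists_isReduced (hZ : IsSpecial Z) {p : AnyPath Q} (hp : IsAdmissible Z p.2.2) :
    ∃ q, IsReduced Z q ∧ ∃ m, p = extend Z q m := by
  induction hN : p.2.2.length using Nat.strong_induction_on generalizing p with
  | _ N ih =>
    by_cases hr : IsReduced Z p
    · exact ⟨p, hr, 0, rfl⟩
    obtain ⟨x, y, p⟩ := p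
    obtain ⟨q, c, hq, hc, rfl⟩ : ∃ (q : Quiver.Path x y) (c : Quiver.Path y y),
        0 < q.length ∧ IsPrimitive Z c ∧ p = q.comp c := by
      by_contra! hcon
      exact hr ⟨hp, hcon⟩
    have hcyc : cycleOf Z ⟨x, y, q⟩ = c := cycleOf_eq hZ hc (hc.isPeriod.lastArrow_eq hZ hp hq)
    have hc0 := hc.1
    rw [Quiver.Path.length_comp] at hN
    obtain ⟨q', hq', m, heq⟩ := ih q.length (by omega) (p := ⟨x, y, q⟩) hp.of_comp_left rfl
    refine ⟨q', hq', m + 1, ?_⟩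
    rw [← extend_extend, ← heq, extend, hcyc, pathPow_one]

theorem not_isReduced_extend_succ {p : AnyPath Q} (h : IsPeriodic Z p) (m : ℕ) :
    ¬ IsReduced Z (extend Z p (m + 1)) := fun hr =>
  hr.2 (extend Z p m).2.2 (cycleOf Z p)
    (length_pos_of_lastArrow_eq (lastArrow_extend p m).symm h.length_pos) h.isPrimitive
    (Quiver.Path.comp_assoc p.2.2 (pathPow (cycleOf Z p) m) (cycleOf Z p)).symm

theorem eq_extend_sub_of_extend_eq {p q : AnyPath Q} {m n : ℕ}
    (hmn : m ≤ n) (h : extend Z p m = extend Z q n) : p = extend Z q (n - m) := by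
  obtain ⟨x, y, p⟩ := p
  obtain ⟨x', y', q⟩ := q
  obtain rfl : x = x' := congrArg Sigma.fst h
  obtain rfl : y = y' := congrArg (fun p : AnyPath Q => p.2.1) h
  simp only [extend, Sigma.mk.injEq, heq_eq_eq, true_and] at h ⊢
  have hcyc : cycleOf Z ⟨x, y, p⟩ = cycleOf Z ⟨x, y, q⟩ := cycleOf_eq_cycleOf <|
    (lastArrow_extend ⟨x, y, p⟩ m).symm.trans <| (congrArg lastArrow h).trans <|
      lastArrow_extend ⟨x, y, q⟩ n
  rw [hcyc, ← Nat.sub_add_cancel hmn, pathPow_add, ← Quiver.Path.comp_assoc] at h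
  exact Quiver.Path.comp_injective_left _ h

theorem IsReduced.eq_of_extend_eq {p q : AnyPath Q} (hp : IsReduced Z p)
    (hq : IsReduced Z q) {m n : ℕ} (h : extend Z p m = extend Z q n) : p = q := by
  wlog hmn : m ≤ n generalizing p q m n
  · exact (this hq hp h.symm (by omega)).symm
  have hpq := eq_extend_sub_of_extend_eq hmn h
  by_cases hper : IsPeriodic Z q
  · cases hk : n - m with
    | zero => rwa [hk, extend_zero] at hpq
    | succ k =>
      rw [hk] at hpq
      exact absurd (hpq ▸ hp) (not_isReduced_extend_succ hper k)
  · rwa [extend_of_not_isPeriodic hper] at hpq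

end Paths

/-! ### Monomial ideals of a path algebra -/

section Monomial

open PathAlgebra

variable {R : Type w} [CommRing R] {Q : Type u} [Quiver.{v} Q]

theorem coord_ofPath_self (p : AnyPath Q) : (basis R Q).coord p (ofPath R p) = 1 := by
  rw [ofPath, Module.Basis.coord_apply, Module.Basis.repr_self, Finsupp.single_eq_same]

theorem coord_ofPath_of_ne {p q : AnyPath Q} (h : p ≠ q) :
    (basis R Q).coord p (ofPath R q) = 0 := by
  rw [ofPath, Module.Basis.coord_apply, Module.Basis.repr_self, Finsupp.single_eq_of_ne h]

theorem ofPath_cons {x y z : Q} (p : Quiver.Path x y) (a : y ⟶ z) :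
    ofPath R ⟨x, z, p.cons a⟩ = ofPath R ⟨y, z, a.toPath⟩ * ofPath R ⟨x, y, p⟩ := by
  rw [ofPath_mul_ofPath_comp, Quiver.Path.comp_toPath_eq_cons]

/-- The submodule of the path algebra spanned by a set of paths. -/
def pathSpan (R : Type w) [CommRing R] (T : Set (AnyPath Q)) : Submodule R (PathAlgebra R Q) :=
  Submodule.span R (ofPath R '' T)

variable {T : Set (AnyPath Q)}

theorem mem_pathSpan_iff {a : PathAlgebra R Q} :
    a ∈ pathSpan R T ↔ ∀ p ∉ T, (basis R Q).coord p a = 0 := by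
  change a ∈ Submodule.span R (basis R Q '' T) ↔ _
  rw [Module.Basis.mem_span_image, Set.subset_def]
  simp only [Finset.mem_coe, Finsupp.mem_support_iff, not_imp_comm, Module.Basis.coord_apply]

theorem ofPath_mem_pathSpan {p : AnyPath Q} (h : p ∈ T) : ofPath R p ∈ pathSpan R T :=
  Submodule.subset_span (Set.mem_image_of_mem _ h)

theorem mul_mem_pathSpan {S T U : Set (AnyPath Q)}
    (h : ∀ ⦃x y z : Q⦄ (p : Quiver.Path x y) (q : Quiver.Path y z),
      ⟨y, z, q⟩ ∈ S → ⟨x, y, p⟩ ∈ T → ⟨x, z, p.comp q⟩ ∈ U)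
    {a b : PathAlgebra R Q} (ha : a ∈ pathSpan R S) (hb : b ∈ pathSpan R T) :
    a * b ∈ pathSpan R U := by
  refine LinearMap.BilinMap.apply_apply_mem_of_mem_span (pathSpan R U) _ _ (mulHom R) ?_ a b ha hb
  rintro _ ⟨⟨y, z, q⟩, hq, rfl⟩ _ ⟨⟨x, y', p⟩, hp, rfl⟩
  rw [← mul_def]
  by_cases hy : y = y'
  · subst hy
    rw [ofPath_mul_ofPath_comp]
    exact ofPath_mem_pathSpan (h p q hq hp)
  · rw [ofPath_mul_ofPath_of_ne hy]
    exact zero_mem _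

theorem pathSpan_univ : pathSpan R (Set.univ : Set (AnyPath Q)) = ⊤ :=
  eq_top_iff.mpr fun _ _ => mem_pathSpan_iff.mpr fun p hp => absurd (Set.mem_univ p) hp

variable [Fintype Q]

/-- The two-sided ideal spanned by a set of paths which contains every path that has an initial or
a terminal part in the set. -/
def pathIdeal (R : Type w) [CommRing R] (T : Set (AnyPath Q))
    (hT : ∀ ⦃x y z : Q⦄ (p : Quiver.Path x y) (q : Quiver.Path y z),
      ⟨x, y, p⟩ ∈ T ∨ ⟨y, z, q⟩ ∈ T → ⟨x, z, p.comp q⟩ ∈ T) :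
    TwoSidedIdeal (PathAlgebra R Q) :=
  TwoSidedIdeal.mk' (pathSpan R T) (zero_mem _) add_mem neg_mem
    (fun hb => mul_mem_pathSpan (fun _ _ _ p q _ hp => hT p q (.inl hp))
      (pathSpan_univ (R := R) (Q := Q) ▸ Submodule.mem_top) hb)
    (fun ha => mul_mem_pathSpan (fun _ _ _ p q hq _ => hT p q (.inr hq)) ha
      (pathSpan_univ (R := R) (Q := Q) ▸ Submodule.mem_top))

theorem mem_pathIdeal {hT} {a : PathAlgebra R Q} : a ∈ pathIdeal R T hT ↔ a ∈ pathSpan R T := by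
  simp only [pathIdeal, TwoSidedIdeal.mem_mk', SetLike.mem_coe]

theorem coord_eq_zero_of_mem_relationIdeal {Z : Set (AnyPath Q)} {a : PathAlgebra R Q}
    (ha : a ∈ relationIdeal R Z) {p : AnyPath Q} (hp : IsAdmissible Z p.2.2) :
    (basis R Q).coord p a = 0 := by
  have hle : relationIdeal R Z ≤ pathIdeal R {p : AnyPath Q | ¬ IsAdmissible Z p.2.2}
      (fun _ _ _ p q h h' => h.elim (· h'.of_comp_left) (· h'.of_comp_right)) := by
    refine TwoSidedIdeal.span_le.mpr ?_
    rintro _ ⟨⟨x, y, p⟩, hp, rfl⟩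
    exact mem_pathIdeal.mpr (ofPath_mem_pathSpan fun h =>
      h _ _ .nil p .nil (Quiver.Path.nil_comp p).symm hp)
  exact mem_pathSpan_iff.mp (mem_pathIdeal.mp (hle ha)) p (not_not_intro hp)

theorem ofPath_mem_relationIdeal {Z : Set (AnyPath Q)} {x y : Q} {p : Quiver.Path x y}
    (h : ¬ IsAdmissible Z p) : ofPath R ⟨x, y, p⟩ ∈ relationIdeal R Z := by
  unfold IsAdmissible at h
  push Not at h
  obtain ⟨x', y', q, z, r, rfl, hz⟩ := h
  rw [← ofPath_mul_ofPath_comp, ← ofPath_mul_ofPath_comp]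
  exact TwoSidedIdeal.mul_mem_left _ _ _ (TwoSidedIdeal.mul_mem_right _ _ _
    (TwoSidedIdeal.subset_span ⟨_, hz, rfl⟩))

theorem ofPath_mem_arrowIdeal_pow {x y : Q} (p : Quiver.Path x y) :
    ofPath R ⟨x, y, p⟩ ∈ (arrowIdeal R Q).asIdeal ^ p.length := by
  induction p with
  | nil =>
    simp only [Quiver.Path.length_nil, Submodule.pow_zero, Ideal.one_eq_top, Submodule.mem_top]
  | cons p a ih =>
    rw [ofPath_cons, Quiver.Path.length_cons, Ideal.IsTwoSided.pow_succ]
    exact Ideal.mul_mem_mul (TwoSidedIdeal.subset_span ⟨_, _, a, rfl⟩) ih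

theorem mem_pathSpan_of_mem_arrowIdeal_pow {d : ℕ} {a : PathAlgebra R Q}
    (ha : a ∈ (arrowIdeal R Q).asIdeal ^ d) :
    a ∈ pathSpan R {p : AnyPath Q | d ≤ p.2.2.length} := by
  have hle : arrowIdeal R Q ≤ pathIdeal R {p : AnyPath Q | 1 ≤ p.2.2.length} (fun _ _ _ p q h => by
      simp only [Set.mem_ofPred_eq, Quiver.Path.length_comp] at h ⊢; omega) := by
    refine TwoSidedIdeal.span_le.mpr ?_
    rintro _ ⟨x, y, f, rfl⟩
    exact mem_pathIdeal.mpr (ofPath_mem_pathSpan (le_refl 1))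
  induction d generalizing a with
  | zero => exact mem_pathSpan_iff.mpr fun p hp => absurd (Nat.zero_le _) hp
  | succ d ih =>
    rw [Ideal.IsTwoSided.pow_succ] at ha
    induction ha using Submodule.mul_induction_on' with
    | mem_mul_mem b hb c hc =>
      refine mul_mem_pathSpan (fun x y z p q hq hp => ?_) (mem_pathIdeal.mp (hle hb)) (ih hc)
      simp only [Set.mem_ofPred_eq, Quiver.Path.length_comp] at hp hq ⊢
      omega
    | add b _ c _ hb hc => exact add_mem hb hc

theorem mem_arrowIdeal_pow_iff {d : ℕ} {a : PathAlgebra R Q} :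
    a ∈ (arrowIdeal R Q).asIdeal ^ d ↔
      ∀ p : AnyPath Q, p.2.2.length < d → (basis R Q).coord p a = 0 := by
  refine ⟨fun ha p hp => mem_pathSpan_iff.mp (mem_pathSpan_of_mem_arrowIdeal_pow ha) p
    (not_le.mpr hp), fun h => ?_⟩
  have hle : pathSpan R {p : AnyPath Q | d ≤ p.2.2.length} ≤
      ((arrowIdeal R Q).asIdeal ^ d).restrictScalars R := by
    refine Submodule.span_le.mpr ?_
    rintro _ ⟨p, hp, rfl⟩
    exact Ideal.pow_le_pow_right hp (ofPath_mem_arrowIdeal_pow p.2.2)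
  exact hle (mem_pathSpan_iff.mpr fun p hp => h p (not_le.mp hp))

end Monomial

/-! ### Homomorphisms out of power series rings and path algebras -/

section Lift

open PathAlgebra

theorem exists_mvPowerSeries_algHom_X_eq {σ k A : Type*} [Finite σ] [CommRing k] [CommRing A]
    [Algebra k A] (t : σ → A) (ht : ∀ i, IsNilpotent (t i)) :
    ∃ ρ : MvPowerSeries σ k →ₐ[k] A, ∀ i, ρ (MvPowerSeries.X i) = t i := by
  let _ : UniformSpace k := ⊥
  let _ : UniformSpace A := ⊥
  have : DiscreteTopology k := inferInstance
  have : DiscreteTopology A := inferInstance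
  have : ContinuousSMul k A := ⟨continuous_of_discreteTopology⟩
  have h : MvPowerSeries.HasEval t :=
    ⟨fun i => (ht i).isTopologicallyNilpotent, by simp only [Filter.cofinite_eq_bot,
      Filter.tendsto_bot]⟩
  refine ⟨MvPowerSeries.aeval h, fun i => ?_⟩
  have hX := MvPowerSeries.aeval_coe (R := k) h (MvPolynomial.X i)
  rwa [MvPolynomial.coe_X, MvPolynomial.aeval_X] at hX

variable {k : Type*} [CommRing k] (R : Type w) [CommRing R] [Algebra k R] {Q : Type u}
  [Quiver.{v} Q] [Fintype Q] {A : Type*} [Ring A] [Algebra k A]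

/-- The `R`-linear extension to `R Q` of an algebra homomorphism on `k Q`. -/
def baseChange [Algebra R A] [IsScalarTower k R A] (π : PathAlgebra k Q →ₐ[k] A) :
    PathAlgebra R Q →ₐ[R] A :=
  let f := (basis R Q).constr R fun p => π (ofPath k p)
  have hf : ∀ p, f (basis R Q p) = π (ofPath k p) := fun p => Module.Basis.constr_basis _ _ _ p
  AlgHom.ofLinearMap f
    (by
      change f (∑ x, vertex R x) = 1
      rw [map_sum, ← map_one π]
      change _ = π (∑ x, vertex k x)
      rw [map_sum]
      exact Finset.sum_congr rfl fun x _ => hf _)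
    (fun a b => by
      suffices h : (mulHom R).compr₂ f = (LinearMap.mul R A).compl₁₂ f f from
        LinearMap.congr_fun₂ h a b
      refine (basis R Q).ext fun p => (basis R Q).ext fun q => ?_
      change f (ofPath R p * ofPath R q) = f (basis R Q p) * f (basis R Q q)
      rw [hf, hf, ← map_mul]
      obtain ⟨y, z, p⟩ := p
      obtain ⟨x, y', q⟩ := q
      by_cases hy : y = y'
      · subst hy
        rw [ofPath_mul_ofPath_comp, ofPath_mul_ofPath_comp]
        exact hf _
      · rw [ofPath_mul_ofPath_of_ne (R := R) hy, ofPath_mul_ofPath_of_ne (R := k) hy, map_zero,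
          map_zero])

theorem baseChange_ofPath [Algebra R A] [IsScalarTower k R A] (π : PathAlgebra k Q →ₐ[k] A)
    (p : AnyPath Q) : baseChange R π (ofPath R p) = π (ofPath k p) :=
  (basis R Q).constr_basis R _ p

variable {R}

/-- The `R`-algebra structure on `A` given by a homomorphism from `R` to the center of `A`. -/
abbrev algebraOfCenter (ρ : R →ₐ[k] Subalgebra.center k A) : Algebra R A :=
  ((Subalgebra.center k A).val.comp ρ).toRingHom.toAlgebra' fun r a =>
    (Subalgebra.mem_center_iff.mp (ρ r).2 a).symm

theorem isScalarTower_algebraOfCenter (ρ : R →ₐ[k] Subalgebra.center k A) :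
    letI := algebraOfCenter ρ
    IsScalarTower k R A :=
  letI := algebraOfCenter ρ
  .of_algebraMap_eq fun c => (((Subalgebra.center k A).val.comp ρ).commutes c).symm

/-- The homomorphism on `R Q` extending a homomorphism on `k Q` and a central homomorphism
on `R`. -/
def liftCentral (ρ : R →ₐ[k] Subalgebra.center k A) (π : PathAlgebra k Q →ₐ[k] A) :
    PathAlgebra R Q →ₐ[k] A :=
  letI := algebraOfCenter ρ
  haveI := isScalarTower_algebraOfCenter ρ
  (baseChange R π).restrictScalars k

theorem liftCentral_smul_ofPath (ρ : R →ₐ[k] Subalgebra.center k A) (π : PathAlgebra k Q →ₐ[k] A)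
    (r : R) (p : AnyPath Q) : liftCentral ρ π (r • ofPath R p) = ρ r * π (ofPath k p) := by
  let := algebraOfCenter ρ
  have := isScalarTower_algebraOfCenter ρ
  change baseChange R π (r • ofPath R p) = _
  rw [map_smul, baseChange_ofPath, Algebra.smul_def]
  rfl

end Lift

/-! ### Periodic arrows and the primitive nerve -/

section Nerve

variable {Q : Type u} [Quiver.{v} Q] {Z : Set (AnyPath Q)}

theorem exists_cycleOf_toPath_eq_cons {x y : Q} {a : x ⟶ y}
    (h : IsPeriodic Z ⟨x, y, a.toPath⟩) :
    ∃ c : Quiver.Path y x, cycleOf Z ⟨x, y, a.toPath⟩ = c.cons a :=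
  exists_eq_cons_of_lastArrow_eq_some h.lastArrow_eq.symm

theorem isPeriodic_toPath_of_isAdmissible_cons (hZ : IsSpecial Z) {x y : Q} {a : x ⟶ y}
    {c : Quiver.Path x x} (hc : IsPrimitive Z c) (h : IsAdmissible Z (c.cons a)) :
    IsPeriodic Z ⟨x, y, a.toPath⟩ := by
  obtain ⟨z, f, d, rfl, -⟩ := c.length_ne_zero_iff_eq_comp.mp hc.1.ne'
  obtain ⟨w, s, b, hs⟩ := (Quiver.Path.length_ne_zero_iff_eq_cons _).mp hc.1.ne'
  have hba : IsAdmissible Z ((s.cons b).comp (a.toPath.comp .nil)) := by rwa [← hs]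
  have hbf : IsAdmissible Z ((s.cons b).comp (f.toPath.comp d)) := by
    rw [← hs]; exact hc.isPeriod.isAdmissible_comp_self
  -- both `a` and the first arrow of `c` can follow the last arrow of `c`
  cases @hZ.1 _ _ b ⟨_, a⟩ hba.twoPath_notMem ⟨_, f⟩ hbf.twoPath_notMem
  have hper : IsPeriod Z (d.cons a) := by
    refine ⟨by simp, fun m => ?_⟩
    have hpow := hc.isPeriod.2 (m + 1)
    rw [pathPow_succ, ← Quiver.Path.comp_assoc, ← toPath_comp_pathPow] at hpow
    exact hpow.of_comp_left.of_comp_right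
  obtain ⟨e, he, hel⟩ := hper.exists_isPrimitive
  exact ⟨e, he, hel.symm⟩

variable {ι : Type*} (e : ι ≃ NerveParts Z)

theorem eq_of_mem_part {i j : ι} {x : Q} (hi : x ∈ part e i) (hj : x ∈ part e j) : i = j := by
  obtain ⟨_, hi⟩ := hi
  obtain ⟨_, hj⟩ := hj
  exact e.injective (hi.symm.trans hj)

theorem mem_part_of_mem_traversed {x y z : Q} {c : Quiver.Path x x} (hc : IsPrimitive Z c)
    (hy : y ∈ traversed c) (hz : z ∈ traversed c) {i : ι} (h : y ∈ part e i) :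
    z ∈ part e i := by
  obtain ⟨hy', h⟩ := h
  refine ⟨⟨x, c, hc, hz⟩, ?_⟩
  rw [← h]
  exact Quotient.sound (Relation.EqvGen.rel _ _ ⟨x, c, hc, hz, hy⟩)

theorem exists_mem_part {x : Q} (h : x ∈ primitiveVertices Z) : ∃ i, x ∈ part e i :=
  ⟨e.symm (Quotient.mk _ ⟨x, h⟩), h, (e.apply_symm_apply _).symm⟩

theorem mem_traversed_head {x y : Q} (p : Quiver.Path x y) : y ∈ traversed p := ⟨p, .nil, rfl⟩

theorem IsPeriodic.mem_primitiveVertices {p : AnyPath Q} (h : IsPeriodic Z p) :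
    p.2.1 ∈ primitiveVertices Z := by
  obtain ⟨c, hc, -⟩ := h
  exact ⟨_, c, hc, mem_traversed_head c⟩

theorem IsPeriodic.mem_part_iff {x y : Q} {a : x ⟶ y}
    (h : IsPeriodic Z ⟨x, y, a.toPath⟩) (i : ι) : y ∈ part e i ↔ x ∈ part e i := by
  obtain ⟨c, hc⟩ := exists_cycleOf_toPath_eq_cons h
  have hprim := h.isPrimitive
  rw [hc] at hprim
  have hx : x ∈ traversed (c.cons a) := ⟨c, a.toPath, rfl⟩
  have hy : y ∈ traversed (c.cons a) := mem_traversed_head _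
  exact ⟨mem_part_of_mem_traversed e hprim hy hx, mem_part_of_mem_traversed e hprim hx hy⟩

end Nerve

/-! ### Sums of primitive cycles -/

section Sigma

open PathAlgebra

variable {R : Type w} [CommRing R] {Q : Type u} [Quiver.{v} Q] [Fintype Q]
  [∀ x y : Q, Finite (x ⟶ y)] {Z : Set (AnyPath Q)}

omit [Fintype Q] in
theorem finite_setOf_isPrimitive [Finite Q] (hZ : IsSpecial Z) (x : Q) :
    {c : Quiver.Path x x | IsPrimitive Z c}.Finite :=
  Set.Finite.of_finite_image (f := lastArrow) (Set.toFinite _)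
    fun _ hc _ hd h => hc.eq_of_lastArrow_eq hZ hd h

theorem sigma_eq_sum (hZ : IsSpecial Z) (x : Q) :
    sigma R Z x = ∑ c ∈ (finite_setOf_isPrimitive hZ x).toFinset, ofPath R ⟨x, x, c⟩ :=
  finsum_mem_eq_finite_toFinset_sum _ _

theorem sigma_mul_ofPath (hZ : IsSpecial Z) {x y : Q} (p : Quiver.Path x y) :
    sigma R Z y * ofPath R ⟨x, y, p⟩
      = ∑ c ∈ (finite_setOf_isPrimitive hZ y).toFinset, ofPath R ⟨x, y, p.comp c⟩ := by
  simp only [sigma_eq_sum hZ, Finset.sum_mul, ofPath_mul_ofPath_comp]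

theorem ofPath_mul_sigma (hZ : IsSpecial Z) {x y : Q} (p : Quiver.Path x y) :
    ofPath R ⟨x, y, p⟩ * sigma R Z x
      = ∑ c ∈ (finite_setOf_isPrimitive hZ x).toFinset, ofPath R ⟨x, y, c.comp p⟩ := by
  simp only [sigma_eq_sum hZ, Finset.mul_sum, ofPath_mul_ofPath_comp]

theorem sigma_mul_ofPath_of_ne (hZ : IsSpecial Z) {z : Q} {p : AnyPath Q} (h : z ≠ p.2.1) :
    sigma R Z z * ofPath R p = 0 := by
  rw [sigma_eq_sum hZ, Finset.sum_mul]
  exact Finset.sum_eq_zero fun c _ => ofPath_mul_ofPath_of_ne h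

theorem ofPath_mul_sigma_of_ne (hZ : IsSpecial Z) {z : Q} {p : AnyPath Q} (h : z ≠ p.1) :
    ofPath R p * sigma R Z z = 0 := by
  rw [sigma_eq_sum hZ, Finset.mul_sum]
  exact Finset.sum_eq_zero fun c _ => ofPath_mul_ofPath_of_ne h.symm

theorem sigma_mul_vertex (hZ : IsSpecial Z) (x : Q) : sigma R Z x * vertex R x = sigma R Z x := by
  rw [vertex, sigma_mul_ofPath hZ, sigma_eq_sum hZ]
  simp only [Quiver.Path.nil_comp]

theorem vertex_mul_sigma (hZ : IsSpecial Z) (x : Q) : vertex R x * sigma R Z x = sigma R Z x := by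
  rw [vertex, ofPath_mul_sigma hZ, sigma_eq_sum hZ]
  simp only [Quiver.Path.comp_nil]

theorem sigma_mem_arrowIdeal (hZ : IsSpecial Z) (x : Q) : sigma R Z x ∈ arrowIdeal R Q := by
  rw [sigma_eq_sum hZ]
  refine sum_mem fun c hc => ?_
  rw [Set.Finite.mem_toFinset] at hc
  obtain ⟨z, q, b, rfl⟩ := (Quiver.Path.length_ne_zero_iff_eq_cons _).mp hc.1.ne'
  rw [ofPath_cons]
  exact TwoSidedIdeal.mul_mem_right _ _ _ (TwoSidedIdeal.subset_span ⟨_, _, b, rfl⟩)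

section Map

variable {A : Type*} [Ring A] [Algebra R A] {φ : PathAlgebra R Q →ₐ[R] A}

omit [∀ x y : Q, Finite (x ⟶ y)] in
theorem map_ofPath_eq_zero (hφ : ∀ a ∈ relationIdeal R Z, φ a = 0) {x y : Q} {p : Quiver.Path x y}
    (h : ¬ IsAdmissible Z p) : φ (ofPath R ⟨x, y, p⟩) = 0 :=
  hφ _ (ofPath_mem_relationIdeal h)

theorem map_sigma_mul_ofPath_of_isPeriodic (hZ : IsSpecial Z)
    (hφ : ∀ a ∈ relationIdeal R Z, φ a = 0) {p : AnyPath Q} (h : IsPeriodic Z p) :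
    φ (sigma R Z p.2.1 * ofPath R p) = φ (ofPath R (extend Z p 1)) := by
  rw [sigma_mul_ofPath hZ p.2.2, map_sum, extend, pathPow_one]
  refine Finset.sum_eq_single_of_mem (cycleOf Z p)
    ((finite_setOf_isPrimitive hZ _).mem_toFinset.mpr h.isPrimitive) fun c hc hne => ?_
  rw [Set.Finite.mem_toFinset] at hc
  exact map_ofPath_eq_zero hφ fun hadm =>
    hne (cycleOf_eq hZ hc (hc.isPeriod.lastArrow_eq hZ hadm h.length_pos)).symm

theorem map_sigma_mul_ofPath_of_not_isPeriodic (hZ : IsSpecial Z)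
    (hφ : ∀ a ∈ relationIdeal R Z, φ a = 0) {p : AnyPath Q} (hp : 0 < p.2.2.length)
    (h : ¬ IsPeriodic Z p) : φ (sigma R Z p.2.1 * ofPath R p) = 0 := by
  rw [sigma_mul_ofPath hZ p.2.2, map_sum]
  refine Finset.sum_eq_zero fun c hc => map_ofPath_eq_zero hφ fun hadm => h ?_
  rw [Set.Finite.mem_toFinset] at hc
  exact ⟨c, hc, hc.isPeriod.lastArrow_eq hZ hadm hp⟩

theorem map_toPath_mul_sigma_of_isPeriodic (hZ : IsSpecial Z)
    (hφ : ∀ a ∈ relationIdeal R Z, φ a = 0) {x y : Q} {a : x ⟶ y}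
    (h : IsPeriodic Z ⟨x, y, a.toPath⟩) :
    φ (ofPath R ⟨x, y, a.toPath⟩ * sigma R Z x)
      = φ (ofPath R (extend Z ⟨x, y, a.toPath⟩ 1)) := by
  obtain ⟨c, hc⟩ := exists_cycleOf_toPath_eq_cons h
  have hprim : IsPrimitive Z (c.cons a) := hc ▸ h.isPrimitive
  have hadm : IsAdmissible Z ((a.toPath.comp c).comp a.toPath) :=
    hprim.isPeriod.isAdmissible_comp hZ
      (hprim.isPeriod.isAdmissible.of_comp_right (q := a.toPath)) rfl
  rw [ofPath_mul_sigma hZ, map_sum, extend, pathPow_one, hc]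
  refine Finset.sum_eq_single_of_mem (a.toPath.comp c)
    ((finite_setOf_isPrimitive hZ x).mem_toFinset.mpr hprim.rotate) fun d hd hne => ?_
  rw [Set.Finite.mem_toFinset] at hd
  exact map_ofPath_eq_zero hφ fun hadm' => hne <| hd.eq_of_lastArrow_eq hZ hprim.rotate <|
    lastArrow_eq_of_isAdmissible_comp hZ hadm' hadm hd.1 hprim.rotate.1 one_pos

theorem map_toPath_mul_sigma_of_not_isPeriodic (hZ : IsSpecial Z)
    (hφ : ∀ a ∈ relationIdeal R Z, φ a = 0) {x y : Q} {a : x ⟶ y}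
    (h : ¬ IsPeriodic Z ⟨x, y, a.toPath⟩) :
    φ (ofPath R ⟨x, y, a.toPath⟩ * sigma R Z x) = 0 := by
  rw [ofPath_mul_sigma hZ, map_sum]
  refine Finset.sum_eq_zero fun c hc => map_ofPath_eq_zero hφ fun hadm => h ?_
  rw [Set.Finite.mem_toFinset] at hc
  exact isPeriodic_toPath_of_isAdmissible_cons hZ hc hadm

end Map

variable {ι : Type*} (e : ι ≃ NerveParts Z)

open Classical in
/-- The sum of the elements `σ_x` over the vertices `x` of one part of the primitive nerve; this is
the element by which the corresponding variable `t_i` acts. -/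
def partSigma (R : Type w) [CommRing R] (e : ι ≃ NerveParts Z) (i : ι) : PathAlgebra R Q :=
  ∑ x with x ∈ part e i, sigma R Z x

theorem partSigma_mem_arrowIdeal (hZ : IsSpecial Z) (i : ι) :
    partSigma R e i ∈ arrowIdeal R Q :=
  sum_mem fun x _ => sigma_mem_arrowIdeal hZ x

open Classical in
theorem partSigma_mul_ofPath (hZ : IsSpecial Z) (i : ι) (p : AnyPath Q) :
    partSigma R e i * ofPath R p
      = if p.2.1 ∈ part e i then sigma R Z p.2.1 * ofPath R p else 0 := by
  simp only [partSigma, Finset.sum_filter, Finset.sum_mul, ite_mul, zero_mul]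
  exact Fintype.sum_eq_single (p.2.1) fun z hz => by rw [sigma_mul_ofPath_of_ne hZ hz, ite_self]

open Classical in
theorem ofPath_mul_partSigma (hZ : IsSpecial Z) (i : ι) (p : AnyPath Q) :
    ofPath R p * partSigma R e i
      = if p.1 ∈ part e i then ofPath R p * sigma R Z p.1 else 0 := by
  simp only [partSigma, Finset.sum_filter, Finset.mul_sum, mul_ite, mul_zero]
  exact Fintype.sum_eq_single p.1 fun z hz => by rw [ofPath_mul_sigma_of_ne hZ hz, ite_self]

theorem commute_partSigma_vertex (hZ : IsSpecial Z) (i : ι) (x : Q) :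
    Commute (partSigma R e i) (vertex R x) := by
  classical
  rw [commute_iff_eq, vertex, partSigma_mul_ofPath e hZ, ofPath_mul_partSigma e hZ]
  exact if_congr .rfl ((sigma_mul_vertex hZ x).trans (vertex_mul_sigma hZ x).symm) rfl

variable {A : Type*} [Ring A] [Algebra R A] {φ : PathAlgebra R Q →ₐ[R] A}

theorem commute_map_partSigma_toPath (hZ : IsSpecial Z) (hφ : ∀ a ∈ relationIdeal R Z, φ a = 0)
    (i : ι) {x y : Q} (a : x ⟶ y) :
    Commute (φ (partSigma R e i)) (φ (ofPath R ⟨x, y, a.toPath⟩)) := by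
  classical
  rw [commute_iff_eq, ← map_mul, ← map_mul, partSigma_mul_ofPath e hZ, ofPath_mul_partSigma e hZ,
    apply_ite φ, apply_ite φ, map_zero]
  by_cases h : IsPeriodic Z ⟨x, y, a.toPath⟩
  · exact if_congr (h.mem_part_iff e i) ((map_sigma_mul_ofPath_of_isPeriodic hZ hφ h).trans
      (map_toPath_mul_sigma_of_isPeriodic hZ hφ h).symm) rfl
  · rw [map_sigma_mul_ofPath_of_not_isPeriodic hZ hφ one_pos h,
      map_toPath_mul_sigma_of_not_isPeriodic hZ hφ h, ite_self, ite_self]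

theorem commute_map_partSigma (hZ : IsSpecial Z) (hφ : ∀ a ∈ relationIdeal R Z, φ a = 0) (i : ι)
    (a : PathAlgebra R Q) : Commute (φ (partSigma R e i)) (φ a) := by
  induction a using PathAlgebra.induction_on with
  | zero => rw [map_zero]; exact Commute.zero_right _
  | add a b ha hb => rw [map_add]; exact ha.add_right hb
  | smul r p =>
    rw [map_smul]
    refine Commute.smul_right ?_ r
    obtain ⟨x, y, p⟩ := p
    induction p with
    | nil => exact (commute_partSigma_vertex e hZ i x).map φ
    | cons p a ih =>
      rw [ofPath_cons, map_mul]
      exact (commute_map_partSigma_toPath e hZ hφ i a).mul_right ih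

end Sigma

/-! ### Generators of the ideal of a string algebra -/

section StringIdeal

open PathAlgebra

variable {R : Type w} [CommRing R] {Q : Type u} [Quiver.{v} Q] [Fintype Q]
  [∀ x y : Q, Finite (x ⟶ y)] {Z : Set (AnyPath Q)} {n : ℕ} (e : Fin n ≃ NerveParts Z)

open Classical in
theorem smul_one_sub_partSigma_mul_vertex (hZ : IsSpecial Z) (i : Fin n) (r : R) (x : Q) :
    (r • 1 - partSigma R e i) * vertex R x
      = if x ∈ part e i then r • vertex R x - sigma R Z x else r • vertex R x := by
  rw [sub_mul, smul_one_mul, vertex, partSigma_mul_ofPath e hZ]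
  split_ifs
  · rw [← vertex, sigma_mul_vertex hZ]
  · rw [sub_zero]

theorem stringIdeal_eq_sup_span (hZ : IsSpecial Z) (s : Fin n → R) :
    stringIdeal Z e s
      = relationIdeal R Z ⊔ TwoSidedIdeal.span (Set.range fun i => s i • 1 - partSigma R e i) := by
  classical
  have hmul := fun i => smul_one_sub_partSigma_mul_vertex e hZ i (s i)
  refine le_antisymm (sup_le_sup le_rfl (iSup_le fun i => sup_le ?_ ?_))
    (sup_le_sup le_rfl (TwoSidedIdeal.span_le.mpr ?_))
  · refine TwoSidedIdeal.span_le.mpr ?_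
    rintro _ ⟨x, hx, rfl⟩
    have := hmul i x
    rw [if_pos hx] at this
    rw [← this]
    exact TwoSidedIdeal.mul_mem_right _ _ _ (TwoSidedIdeal.subset_span ⟨i, rfl⟩)
  · refine TwoSidedIdeal.span_le.mpr ?_
    rintro _ ⟨x, hx, rfl⟩
    have := hmul i x
    rw [if_neg hx] at this
    rw [← this]
    exact TwoSidedIdeal.mul_mem_right _ _ _ (TwoSidedIdeal.subset_span ⟨i, rfl⟩)
  · rintro _ ⟨i, rfl⟩
    refine SetLike.le_def.mp (le_iSup _ i) ?_
    have hsum : s i • 1 - partSigma R e i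
        = ∑ x, (s i • 1 - partSigma R e i) * vertex R x := by
      rw [← Finset.mul_sum]
      exact (mul_one _).symm
    change s i • 1 - partSigma R e i ∈ _
    rw [hsum]
    refine sum_mem fun x _ => ?_
    rw [hmul]
    split_ifs with hx
    · exact TwoSidedIdeal.mem_sup_left (TwoSidedIdeal.subset_span ⟨x, hx, rfl⟩)
    · exact TwoSidedIdeal.mem_sup_right (TwoSidedIdeal.subset_span ⟨x, hx, rfl⟩)

variable {e} {s : Fin n → R} {A : Type*} [Ring A] [Algebra R A] {φ : PathAlgebra R Q →ₐ[R] A}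

theorem smul_map_eq_map_partSigma_mul (hZ : IsSpecial Z) (hφ : ∀ a ∈ stringIdeal Z e s, φ a = 0)
    (i : Fin n) (a : PathAlgebra R Q) : s i • φ a = φ (partSigma R e i * a) := by
  have h : (s i • 1 - partSigma R e i) * a ∈ stringIdeal Z e s := by
    rw [stringIdeal_eq_sup_span e hZ]
    exact TwoSidedIdeal.mul_mem_right _ _ _
      (TwoSidedIdeal.mem_sup_right (TwoSidedIdeal.subset_span ⟨i, rfl⟩))
  rw [← map_smul, ← sub_eq_zero, ← map_sub, ← smul_one_mul, ← sub_mul]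
  exact hφ _ h

omit [∀ x y : Q, Finite (x ⟶ y)] in
theorem map_eq_zero_of_mem_relationIdeal (hφ : ∀ a ∈ stringIdeal Z e s, φ a = 0) :
    ∀ a ∈ relationIdeal R Z, φ a = 0 :=
  fun a ha => hφ a (TwoSidedIdeal.mem_sup_left ha)

/-- The path `p` is periodic and its head lies in the `i`-th part of the primitive nerve. -/
def IsPeriodicAt {ι : Type*} (e : ι ≃ NerveParts Z) (p : AnyPath Q) (i : ι) : Prop :=
  IsPeriodic Z p ∧ p.2.1 ∈ part e i

theorem smul_map_ofPath_of_isPeriodicAt (hZ : IsSpecial Z)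
    (hφ : ∀ a ∈ stringIdeal Z e s, φ a = 0) {p : AnyPath Q} {i : Fin n} (h : IsPeriodicAt e p i) :
    s i • φ (ofPath R p) = φ (ofPath R (extend Z p 1)) := by
  rw [smul_map_eq_map_partSigma_mul hZ hφ, partSigma_mul_ofPath e hZ, if_pos h.2]
  exact map_sigma_mul_ofPath_of_isPeriodic hZ (map_eq_zero_of_mem_relationIdeal hφ) h.1

theorem smul_map_ofPath_of_not_isPeriodicAt (hZ : IsSpecial Z)
    (hφ : ∀ a ∈ stringIdeal Z e s, φ a = 0) {p : AnyPath Q} (hp : 0 < p.2.2.length) {i : Fin n}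
    (h : ¬ IsPeriodicAt e p i) : s i • φ (ofPath R p) = 0 := by
  rw [smul_map_eq_map_partSigma_mul hZ hφ, partSigma_mul_ofPath e hZ]
  split_ifs with hi
  · exact map_sigma_mul_ofPath_of_not_isPeriodic hZ (map_eq_zero_of_mem_relationIdeal hφ) hp
      fun hper => h ⟨hper, hi⟩
  · exact map_zero φ

theorem pow_smul_map_ofPath (hZ : IsSpecial Z) (hφ : ∀ a ∈ stringIdeal Z e s, φ a = 0)
    {p : AnyPath Q} {i : Fin n} (h : IsPeriodicAt e p i) (m : ℕ) :
    s i ^ m • φ (ofPath R p) = φ (ofPath R (extend Z p m)) := by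
  induction m with
  | zero => rw [pow_zero, one_smul, extend_zero]
  | succ m ih =>
    have hm : IsPeriodicAt e (extend Z p m) i :=
      ⟨⟨_, h.1.isPrimitive, (lastArrow_extend p m).trans h.1.lastArrow_eq⟩, h.2⟩
    rw [pow_succ', mul_smul, ih, smul_map_ofPath_of_isPeriodicAt hZ hφ hm, extend_extend]

end StringIdeal

/-! ### Normal forms -/

section Exponents

variable {Q : Type u} [Quiver.{v} Q] {Z : Set (AnyPath Q)} {ι : Type*} (e : ι ≃ NerveParts Z)

theorem IsPeriodic.exists_isPeriodicAt {p : AnyPath Q} (h : IsPeriodic Z p) :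
    ∃ i, IsPeriodicAt e p i :=
  (exists_mem_part e h.mem_primitiveVertices).imp fun _ hi => ⟨h, hi⟩

/-- The exponents of the monomials which act on the path `p` by extension. -/
def exponents (p : AnyPath Q) : Set (ι →₀ ℕ) :=
  {α | ∀ i, α i ≠ 0 → IsPeriodicAt e p i}

theorem zero_mem_exponents (p : AnyPath Q) : 0 ∈ exponents e p := fun _ h => absurd rfl h

variable {e} {p : AnyPath Q} {α β : ι →₀ ℕ}

theorem single_mem_exponents {i : ι} (h : IsPeriodicAt e p i) (m : ℕ) :
    Finsupp.single i m ∈ exponents e p := fun j hj => by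
  obtain rfl : i = j := by
    by_contra hne
    exact hj (Finsupp.single_eq_of_ne' hne)
  exact h

theorem eq_single_of_mem_exponents {i : ι} (h : IsPeriodicAt e p i) (hα : α ∈ exponents e p) :
    α = Finsupp.single i α.degree := by
  obtain ⟨m, rfl⟩ : ∃ m, α = Finsupp.single i m :=
    ⟨α i, Finsupp.eq_single_iff.mpr ⟨fun j hj => Finset.mem_singleton.mpr
      (eq_of_mem_part e (hα j (Finsupp.mem_support_iff.mp hj)).2 h.2), rfl⟩⟩
  rw [Finsupp.degree_single]

theorem eq_zero_of_mem_exponents (h : ¬ IsPeriodic Z p) (hα : α ∈ exponents e p) : α = 0 :=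
  Finsupp.ext fun j => not_not.mp fun hj => h (hα j hj).1

theorem eq_of_extend_degree_eq (hα : α ∈ exponents e p) (hβ : β ∈ exponents e p)
    (h : extend Z p α.degree = extend Z p β.degree) : α = β := by
  by_cases hp : IsPeriodic Z p
  · obtain ⟨i, hi⟩ := hp.exists_isPeriodicAt e
    rw [eq_single_of_mem_exponents hi hα, eq_single_of_mem_exponents hi hβ, hp.extend_injective h]
  · rw [eq_zero_of_mem_exponents hp hα, eq_zero_of_mem_exponents hp hβ]

variable (e p) in
theorem exists_mem_exponents (m : ℕ) :
    ∃ α ∈ exponents e p, extend Z p α.degree = extend Z p m := by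
  by_cases h : IsPeriodic Z p
  · obtain ⟨i, hi⟩ := h.exists_isPeriodicAt e
    exact ⟨_, single_mem_exponents hi m, by rw [Finsupp.degree_single]⟩
  · exact ⟨0, zero_mem_exponents e p, by simp only [extend_of_not_isPeriodic h]⟩

variable {k : Type*} [CommRing k]

variable (e) in
open Classical in
/-- The power series `f` such that, modulo the ideal of the string algebra, `f • p` is the formal
sum of the paths `extend Z p m` with coefficients given by `a`. -/
def extensionSeries (p : AnyPath Q) : (AnyPath Q → k) →ₗ[k] MvPowerSeries ι k :=
  LinearMap.pi fun α => if α ∈ exponents e p then LinearMap.proj (extend Z p α.degree) else 0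

open Classical in
theorem coeff_extensionSeries (p : AnyPath Q) (a : AnyPath Q → k) (α : ι →₀ ℕ) :
    MvPowerSeries.coeff α (extensionSeries e p a) =
      if α ∈ exponents e p then a (extend Z p α.degree) else 0 := by
  change (if α ∈ exponents e p then LinearMap.proj (extend Z p α.degree) else 0 : _ →ₗ[k] k) a = _
  split_ifs <;> rfl

theorem extensionSeries_eq_zero {a : AnyPath Q → k} (h : ∀ m, a (extend Z p m) = 0) :
    extensionSeries e p a = 0 := by
  classical
  ext α
  rw [coeff_extensionSeries, h, ite_self, map_zero]

theorem extensionSeries_single [DecidableEq (AnyPath Q)] (hα : α ∈ exponents e p) :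
    extensionSeries e p (Pi.single (extend Z p α.degree) (1 : k)) = MvPowerSeries.monomial α 1 := by
  classical
  ext β
  rw [coeff_extensionSeries, MvPowerSeries.coeff_monomial, Pi.single_apply, ← ite_and]
  refine if_congr ⟨fun h => eq_of_extend_degree_eq h.1 hα h.2, ?_⟩ rfl rfl
  rintro rfl
  exact ⟨hα, rfl⟩

theorem exists_extensionSeries_eq {f : MvPowerSeries ι k}
    (hf : ∀ α ∉ exponents e p, MvPowerSeries.coeff α f = 0) :
    ∃ a : AnyPath Q → k, extensionSeries e p a = f ∧ ∀ q, (∀ m, extend Z p m ≠ q) → a q = 0 := by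
  classical
  have hinj : Function.Injective fun α : exponents e p => extend Z p α.1.degree :=
    fun α β h => Subtype.ext (eq_of_extend_degree_eq α.2 β.2 h)
  refine ⟨Function.extend (fun α : exponents e p => extend Z p α.1.degree)
    (fun α => MvPowerSeries.coeff α.1 f) 0, ?_, fun q hq => ?_⟩
  · ext α
    rw [coeff_extensionSeries]
    split_ifs with hα
    · exact hinj.extend_apply _ _ ⟨α, hα⟩
    · exact (hf α hα).symm
  · exact Function.extend_apply' _ _ _ fun ⟨α, hα⟩ => hq _ hα

end Exponents

theorem mem_span_X_image_of_coeff_eq_zero {σ k : Type*} [Finite σ] [CommRing k] {S : Set σ}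
    {f : MvPowerSeries σ k}
    (h : ∀ α : σ →₀ ℕ, (∀ i ∈ S, α i = 0) → MvPowerSeries.coeff α f = 0) :
    f ∈ Ideal.span ((MvPowerSeries.X : σ → MvPowerSeries σ k) '' S) := by
  classical
  induction S, S.toFinite using Set.Finite.induction_on generalizing f with
  | empty =>
    obtain rfl : f = 0 := MvPowerSeries.ext fun α => by simpa using h α
    exact zero_mem _
  | @insert j S _ _ ih =>
    -- split off the terms which are not divisible by `X j`
    let g : MvPowerSeries σ k := fun α => if α j = 0 then MvPowerSeries.coeff α f else 0
    have hg : ∀ α, MvPowerSeries.coeff α g = if α j = 0 then MvPowerSeries.coeff α f else 0 :=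
      fun _ => rfl
    have hgS : g ∈ Ideal.span (MvPowerSeries.X '' S) := ih fun α hα => by
      rw [hg]
      split_ifs with hj
      · exact h α (Set.forall_mem_insert.mpr ⟨hj, hα⟩)
      · rfl
    have hX : MvPowerSeries.X j ∣ f - g := MvPowerSeries.X_dvd_iff.mpr fun α hα => by
      rw [map_sub, hg, if_pos hα, sub_self]
    rw [← sub_add_cancel f g, Set.image_insert_eq]
    exact add_mem (Ideal.mem_of_dvd _ hX (Ideal.subset_span (Set.mem_insert _ _)))
      (Ideal.span_mono (Set.subset_insert _ _) hgS)

section NormalForm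

open PathAlgebra

variable {k : Type*} [CommRing k] {Q : Type u} [Quiver.{v} Q] [Finite Q]
  [∀ x y : Q, Finite (x ⟶ y)] {Z : Set (AnyPath Q)} {ι : Type*} (e : ι ≃ NerveParts Z)

/-- The element of the path algebra over power series attached to a formal sum `a` of paths: the
terms of `a` at the extensions of a reduced path are collected in the coefficient of this path. -/
def normalForm (hZ : IsSpecial Z) : (AnyPath Q → k) →ₗ[k] PathAlgebra (MvPowerSeries ι k) Q :=
  ∑ p ∈ (finite_setOf_isReduced hZ).toFinset, (extensionSeries e p).smulRight (ofPath _ p)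

variable {e}

theorem normalForm_apply (hZ : IsSpecial Z) (a : AnyPath Q → k) :
    normalForm e hZ a
      = ∑ p ∈ (finite_setOf_isReduced hZ).toFinset, extensionSeries e p a • ofPath _ p := by
  simp only [normalForm, LinearMap.sum_apply, LinearMap.smulRight_apply]

theorem normalForm_eq_zero (hZ : IsSpecial Z) {a : AnyPath Q → k}
    (h : ∀ p : AnyPath Q, IsAdmissible Z p.2.2 → a p = 0) : normalForm e hZ a = 0 := by
  rw [normalForm_apply]
  refine Finset.sum_eq_zero fun p hp => ?_
  rw [Set.Finite.mem_toFinset] at hp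
  rw [extensionSeries_eq_zero fun m => h _ (isAdmissible_extend hZ hp.1 m), zero_smul]

theorem normalForm_eq_smul (hZ : IsSpecial Z) {q : AnyPath Q} (hq : IsReduced Z q)
    {a : AnyPath Q → k} (h : ∀ p, (∀ m, extend Z q m ≠ p) → a p = 0) :
    normalForm e hZ a = extensionSeries e q a • ofPath _ q := by
  rw [normalForm_apply]
  refine Finset.sum_eq_single_of_mem q ((Set.Finite.mem_toFinset _).mpr hq) fun p hp hpq => ?_
  rw [Set.Finite.mem_toFinset] at hp
  rw [extensionSeries_eq_zero fun m => h _ fun m' heq => hpq (hp.eq_of_extend_eq hq heq.symm),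
    zero_smul]

end NormalForm

section NormalFormModulo

open PathAlgebra

variable {k : Type*} [CommRing k] {Q : Type u} [Quiver.{v} Q] [Fintype Q]
  [∀ x y : Q, Finite (x ⟶ y)] {Z : Set (AnyPath Q)} {n : ℕ} {e : Fin n ≃ NerveParts Z}
  {A : Type*} [Ring A] [Algebra (MvPowerSeries (Fin n) k) A]
  {φ : PathAlgebra (MvPowerSeries (Fin n) k) Q →ₐ[MvPowerSeries (Fin n) k] A}

theorem monomial_smul_map_ofPath (hZ : IsSpecial Z)
    (hφ : ∀ a ∈ stringIdeal Z e MvPowerSeries.X, φ a = 0) {p : AnyPath Q} {α : Fin n →₀ ℕ}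
    (hα : α ∈ exponents e p) :
    MvPowerSeries.monomial α (1 : k) • φ (ofPath _ p) = φ (ofPath _ (extend Z p α.degree)) := by
  by_cases hp : IsPeriodic Z p
  · obtain ⟨i, hi⟩ := hp.exists_isPeriodicAt e
    rw [← pow_smul_map_ofPath hZ hφ hi, MvPowerSeries.X_pow_eq, ← eq_single_of_mem_exponents hi hα]
  · rw [extend_of_not_isPeriodic hp, eq_zero_of_mem_exponents hp hα,
      MvPowerSeries.monomial_zero_one, one_smul]

theorem map_normalForm_single [DecidableEq (AnyPath Q)] (hZ : IsSpecial Z)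
    (hφ : ∀ a ∈ stringIdeal Z e MvPowerSeries.X, φ a = 0) (p : AnyPath Q) :
    φ (normalForm e hZ (Pi.single p (1 : k))) = φ (ofPath _ p) := by
  by_cases hp : IsAdmissible Z p.2.2
  · obtain ⟨q, hq, m, rfl⟩ := exists_isReduced hZ hp
    obtain ⟨α, hα, hαm⟩ := exists_mem_exponents e q m
    rw [normalForm_eq_smul hZ hq fun p hp => Pi.single_eq_of_ne' (hp m) _, map_smul, ← hαm,
      extensionSeries_single hα, monomial_smul_map_ofPath hZ hφ hα]
  · rw [map_ofPath_eq_zero (map_eq_zero_of_mem_relationIdeal hφ) hp,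
      normalForm_eq_zero hZ, map_zero]
    intro q hq
    refine Pi.single_eq_of_ne ?_ _
    rintro rfl
    exact hp hq

variable (e φ) in
/-- The image under `φ` of the set of normal forms. -/
def normalFormImage (hZ : IsSpecial Z) : AddSubgroup A :=
  (normalForm e hZ).toAddMonoidHom.range.map (φ : PathAlgebra (MvPowerSeries (Fin n) k) Q →+ A)

theorem mem_normalFormImage {hZ : IsSpecial Z} {y : A} :
    y ∈ normalFormImage e φ hZ ↔ ∃ a : AnyPath Q → k, φ (normalForm e hZ a) = y := by
  simp only [normalFormImage, AddSubgroup.mem_map, AddMonoidHom.mem_range,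
    exists_exists_eq_and]
  rfl

theorem smul_map_ofPath_mem_of_isReduced {hZ : IsSpecial Z} {q : AnyPath Q} (hq : IsReduced Z q)
    (h : ∀ i, ¬ IsPeriodicAt e q i → ∀ g : MvPowerSeries (Fin n) k,
      (g * MvPowerSeries.X i) • φ (ofPath _ q) ∈ normalFormImage e φ hZ)
    (f : MvPowerSeries (Fin n) k) : f • φ (ofPath _ q) ∈ normalFormImage e φ hZ := by
  classical
  let f₁ : MvPowerSeries (Fin n) k := fun α =>
    if α ∈ exponents e q then MvPowerSeries.coeff α f else 0
  have hf₁ : ∀ α, MvPowerSeries.coeff α f₁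
    = if α ∈ exponents e q then MvPowerSeries.coeff α f else 0 := fun _ => rfl
  have hmem₁ : f₁ • φ (ofPath _ q) ∈ normalFormImage e φ hZ := by
    obtain ⟨a, ha, ha'⟩ := exists_extensionSeries_eq fun α hα => (hf₁ α).trans (if_neg hα)
    refine mem_normalFormImage.mpr ⟨a, ?_⟩
    rw [normalForm_eq_smul hZ hq ha', ha, map_smul]
  have hspan : f - f₁ ∈ Ideal.span (MvPowerSeries.X '' {i | ¬ IsPeriodicAt e q i}) :=
    mem_span_X_image_of_coeff_eq_zero fun α hα => by
      have hmem : α ∈ exponents e q := fun i => not_imp_comm.mp (hα i)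
      rw [map_sub, hf₁, if_pos hmem, sub_self]
  have hideal : ∀ f₂ ∈ Ideal.span (MvPowerSeries.X '' {i | ¬ IsPeriodicAt e q i}),
      ∀ g : MvPowerSeries (Fin n) k, (g * f₂) • φ (ofPath _ q) ∈ normalFormImage e φ hZ := by
    intro f₂ hf₂
    induction hf₂ using Submodule.span_induction with
    | mem _ hx => obtain ⟨i, hi, rfl⟩ := hx; exact h i hi
    | zero => intro g; rw [mul_zero, zero_smul]; exact zero_mem _
    | add x y _ _ hx hy => intro g; rw [mul_add, add_smul]; exact add_mem (hx g) (hy g)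
    | smul r x _ hx => intro g; rw [smul_eq_mul, ← mul_assoc]; exact hx _
  rw [← sub_add_cancel f f₁, add_smul, ← one_mul (f - f₁)]
  exact add_mem (hideal _ hspan 1) hmem₁

theorem smul_map_ofPath_mem_of_length_pos {hZ : IsSpecial Z}
    (hφ : ∀ a ∈ stringIdeal Z e MvPowerSeries.X, φ a = 0) {p : AnyPath Q}
    (hp0 : 0 < p.2.2.length) (f : MvPowerSeries (Fin n) k) :
    f • φ (ofPath _ p) ∈ normalFormImage e φ hZ := by
  by_cases hp : IsAdmissible Z p.2.2
  · obtain ⟨q, hq, m, rfl⟩ := exists_isReduced hZ hp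
    obtain ⟨α, hα, hαm⟩ := exists_mem_exponents e q m
    have hq0 : 0 < q.2.2.length := length_pos_of_lastArrow_eq (lastArrow_extend q m) hp0
    rw [← hαm, ← monomial_smul_map_ofPath hZ hφ hα, smul_smul]
    refine smul_map_ofPath_mem_of_isReduced hq (fun i hi g => ?_) _
    rw [mul_smul, smul_map_ofPath_of_not_isPeriodicAt hZ hφ hq0 hi, smul_zero]
    exact zero_mem _
  · rw [map_ofPath_eq_zero (map_eq_zero_of_mem_relationIdeal hφ) hp, smul_zero]
    exact zero_mem _

theorem smul_map_vertex_mem {hZ : IsSpecial Z}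
    (hφ : ∀ a ∈ stringIdeal Z e MvPowerSeries.X, φ a = 0) (x : Q)
    (f : MvPowerSeries (Fin n) k) : f • φ (vertex _ x) ∈ normalFormImage e φ hZ := by
  by_cases hx : IsAdmissible Z (.nil : Quiver.Path x x)
  · refine smul_map_ofPath_mem_of_isReduced (isReduced_nil hx) (fun i _ g => ?_) f
    rw [mul_smul, smul_map_eq_map_partSigma_mul hZ hφ, partSigma_mul_ofPath e hZ]
    split_ifs
    · rw [← vertex, sigma_mul_vertex hZ, sigma_eq_sum hZ, map_sum, Finset.smul_sum]
      refine sum_mem fun c hc => smul_map_ofPath_mem_of_length_pos hφ ?_ _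
      exact ((Set.Finite.mem_toFinset _).mp hc).1
    · rw [map_zero, smul_zero]
      exact zero_mem _
  · rw [vertex, map_ofPath_eq_zero (map_eq_zero_of_mem_relationIdeal hφ) hx, smul_zero]
    exact zero_mem _

theorem exists_map_normalForm_eq (hZ : IsSpecial Z)
    (hφ : ∀ a ∈ stringIdeal Z e MvPowerSeries.X, φ a = 0)
    (y : PathAlgebra (MvPowerSeries (Fin n) k) Q) :
    ∃ a : AnyPath Q → k, φ (normalForm e hZ a) = φ y := by
  rw [← mem_normalFormImage]
  induction y using PathAlgebra.induction_on with
  | zero => rw [map_zero]; exact zero_mem _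
  | add y z hy hz => rw [map_add]; exact add_mem hy hz
  | smul f p =>
    rw [map_smul]
    obtain ⟨x, y, _ | ⟨p, a⟩⟩ := p
    · exact smul_map_vertex_mem hφ x f
    · exact smul_map_ofPath_mem_of_length_pos (p := ⟨x, _, p.cons a⟩) hφ (Nat.succ_pos _) f

end NormalFormModulo

/-! ### Truncations -/

instance isTwoSided_sup {A : Type*} [Ring A] (I J : Ideal A) [I.IsTwoSided] [J.IsTwoSided] :
    (I ⊔ J).IsTwoSided where
  mul_mem_of_left b ha := by
    obtain ⟨x, hx, y, hy, rfl⟩ := Submodule.mem_sup.mp ha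
    rw [add_mul]
    exact add_mem (Ideal.mem_sup_left (I.mul_mem_right b hx))
      (Ideal.mem_sup_right (J.mul_mem_right b hy))

theorem nonempty_quotient_algEquiv_of_range_eq {k A B C : Type*} [CommRing k] [Ring A] [Ring B]
    [Ring C] [Algebra k A] [Algebra k B] [Algebra k C] {f : A →ₐ[k] C} {g : B →ₐ[k] C}
    (h : f.range = g.range) {I : Ideal A} {J : Ideal B} [I.IsTwoSided] [J.IsTwoSided]
    (hI : RingHom.ker f = I) (hJ : RingHom.ker g = J) : Nonempty ((A ⧸ I) ≃ₐ[k] (B ⧸ J)) := by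
  subst hI hJ
  exact ⟨(Ideal.quotientKerEquivRange f).trans
    ((Subalgebra.equivOfEq _ _ h).trans (Ideal.quotientKerEquivRange g).symm)⟩

theorem linearMap_pi_ext_of_finite {X k M : Type*} [DecidableEq X] [Ring k] [AddCommGroup M]
    [Module k M] {f g : (X → k) →ₗ[k] M} {S : Set X} (hS : S.Finite)
    (h : ∀ x ∈ S, f (Pi.single x 1) = g (Pi.single x 1))
    (h₀ : ∀ a, (∀ x ∈ S, a x = 0) → f a = g a) : f = g := by
  ext a
  let b : X → k := ∑ x ∈ hS.toFinset, a x • Pi.single x 1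
  have hb : f b = g b := by
    simp only [b, map_sum, map_smul]
    exact Finset.sum_congr rfl fun x hx => by rw [h x (hS.mem_toFinset.mp hx)]
  have hab : f (a - b) = g (a - b) := h₀ _ fun x hx => by
    simp [b, Finset.sum_apply, Pi.single_apply, hx]
  rw [← sub_add_cancel a b, map_add, map_add, hab, hb]

section Truncation

open PathAlgebra

variable (k : Type*) [CommRing k] {Q : Type u} [Quiver.{v} Q] [Fintype Q] (Z : Set (AnyPath Q))

/-- The ideal `⟨Z⟩ + B ^ d`. -/
def truncIdeal (d : ℕ) : Ideal (PathAlgebra k Q) :=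
  (relationIdeal k Z).asIdeal ⊔ (arrowIdeal k Q).asIdeal ^ d

instance (d : ℕ) : (truncIdeal k Z d).IsTwoSided :=
  inferInstanceAs (_ ⊔ _ : Ideal _).IsTwoSided

/-- The homomorphism from the completed path algebra to the product of the truncations
`k Q / (⟨Z⟩ + B ^ d)`. -/
def completionToTrunc : Completion k (arrowIdeal k Q).asIdeal →ₐ[k]
    ∀ d, PathAlgebra k Q ⧸ truncIdeal k Z d :=
  AlgHom.pi fun d => (Ideal.Quotient.factorₐ k le_sup_right).comp
    ((Pi.evalAlgHom k _ d).comp (Completion k (arrowIdeal k Q).asIdeal).val)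

variable {k Z}

theorem coord_eq_zero_of_mem_truncIdeal {d : ℕ} {z : PathAlgebra k Q}
    (hz : z ∈ truncIdeal k Z d) {p : AnyPath Q} (hp : IsAdmissible Z p.2.2)
    (hd : p.2.2.length < d) : (basis k Q).coord p z = 0 := by
  obtain ⟨x, hx, y, hy, rfl⟩ := Submodule.mem_sup.mp hz
  rw [map_add, mem_arrowIdeal_pow_iff.mp hy p hd, add_zero]
  exact coord_eq_zero_of_mem_relationIdeal hx hp

theorem completionToTrunc_apply_of_eq_mk {x : Completion k (arrowIdeal k Q).asIdeal} {d : ℕ}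
    {y : PathAlgebra k Q} (h : x.1 d = Ideal.Quotient.mk _ y) :
    completionToTrunc k Z x d = Ideal.Quotient.mk _ y := by
  change Ideal.Quotient.factorₐ k (show _ ≤ truncIdeal k Z d from le_sup_right) (x.1 d) = _
  rw [h]
  rfl

theorem ker_completionToTrunc :
    RingHom.ker (completionToTrunc k Z) =
      closureIdeal k (arrowIdeal k Q).asIdeal (relationIdeal k Z).asIdeal := by
  ext x
  rw [RingHom.mem_ker, funext_iff]
  refine forall_congr' fun d => ?_
  obtain ⟨y, hy⟩ := Ideal.Quotient.mk_surjective (x.1 d)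
  rw [completionToTrunc_apply_of_eq_mk hy.symm, ← hy, Pi.zero_apply,
    Ideal.Quotient.eq_zero_iff_mem, truncIdeal, Submodule.mem_sup]
  constructor
  · rintro ⟨h, hh, b, hb, rfl⟩
    refine ⟨h, hh, ?_⟩
    rwa [Ideal.Quotient.eq, add_sub_cancel_left]
  · rintro ⟨h, hh, he⟩
    exact ⟨h, hh, y - h, Ideal.Quotient.eq.mp he, add_sub_cancel _ _⟩

variable [∀ x y : Q, Finite (x ⟶ y)]

/-- The truncation of a formal sum of paths to the paths of length less than `d`. -/
def truncate (d : ℕ) : (AnyPath Q → k) →ₗ[k] PathAlgebra k Q :=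
  ∑ p ∈ (finite_setOf_length_lt Q d).toFinset, (LinearMap.proj p).smulRight (ofPath k p)

theorem truncate_apply (d : ℕ) (a : AnyPath Q → k) :
    truncate d a = ∑ p ∈ (finite_setOf_length_lt Q d).toFinset, a p • ofPath k p := by
  simp only [truncate, LinearMap.sum_apply, LinearMap.smulRight_apply, LinearMap.proj_apply]

theorem coord_truncate (a : AnyPath Q → k) {d : ℕ} {p : AnyPath Q} (hp : p.2.2.length < d) :
    (basis k Q).coord p (truncate d a) = a p := by
  rw [truncate_apply, map_sum,
    Finset.sum_eq_single_of_mem p ((Set.Finite.mem_toFinset _).mpr hp)]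
  · rw [map_smul, coord_ofPath_self, smul_eq_mul, mul_one]
  · intro q _ hq
    rw [map_smul, coord_ofPath_of_ne hq.symm, smul_zero]

theorem mk_eq_mk_truncate {a : AnyPath Q → k} {d : ℕ} {z : PathAlgebra k Q}
    (h : ∀ p : AnyPath Q, p.2.2.length < d → (basis k Q).coord p z = a p) :
    Ideal.Quotient.mk ((arrowIdeal k Q).asIdeal ^ d) z = Ideal.Quotient.mk _ (truncate d a) := by
  rw [Ideal.Quotient.eq, mem_arrowIdeal_pow_iff]
  intro p hp
  rw [map_sub, h p hp, coord_truncate a hp, sub_self]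

/-- The element of the completed path algebra given by a formal sum of paths. -/
def ofCoeffs (a : AnyPath Q → k) : Completion k (arrowIdeal k Q).asIdeal :=
  ⟨fun d => Ideal.Quotient.mk _ (truncate d a), fun _ _ h => by
    change Ideal.Quotient.mk _ _ = _
    exact mk_eq_mk_truncate fun p hp => coord_truncate a (hp.trans_le h)⟩

theorem ofCoeffs_surjective :
    Function.Surjective (ofCoeffs : (AnyPath Q → k) → Completion k (arrowIdeal k Q).asIdeal) := by
  intro x
  choose y hy using fun d => Ideal.Quotient.mk_surjective (x.1 d)
  refine ⟨fun p => (basis k Q).coord p (y (p.2.2.length + 1)), Subtype.ext (funext fun d => ?_)⟩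
  rw [← hy d]
  refine (mk_eq_mk_truncate fun p hp => ?_).symm
  have h := x.2 (show p.2.2.length + 1 ≤ d from hp)
  rw [← hy, ← hy] at h
  change Ideal.Quotient.mk _ (y d) = _ at h
  rw [Ideal.Quotient.eq, mem_arrowIdeal_pow_iff] at h
  rw [← sub_eq_zero, ← map_sub]
  exact h p (Nat.lt_succ_self _)

theorem completionToTrunc_ofCoeffs (a : AnyPath Q → k) (d : ℕ) :
    completionToTrunc k Z (ofCoeffs a) d = Ideal.Quotient.mk _ (truncate d a) :=
  completionToTrunc_apply_of_eq_mk rfl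

theorem eq_zero_of_completionToTrunc_ofCoeffs_eq_zero {a : AnyPath Q → k}
    (h : completionToTrunc k Z (ofCoeffs a) = 0) {p : AnyPath Q} (hp : IsAdmissible Z p.2.2) :
    a p = 0 := by
  have hd := congrFun h (p.2.2.length + 1)
  rw [completionToTrunc_ofCoeffs, Pi.zero_apply, Ideal.Quotient.eq_zero_iff_mem] at hd
  rw [← coord_truncate a (Nat.lt_succ_self _)]
  exact coord_eq_zero_of_mem_truncIdeal hd hp (Nat.lt_succ_self _)

end Truncation

section TruncHom

open PathAlgebra

variable {k : Type*} [CommRing k] {Q : Type u} [Quiver.{v} Q] [Fintype Q]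
  [∀ x y : Q, Finite (x ⟶ y)] {Z : Set (AnyPath Q)} {n : ℕ} (e : Fin n ≃ NerveParts Z)

theorem mk_partSigma_pow (hZ : IsSpecial Z) (i : Fin n) (d : ℕ) :
    Ideal.Quotient.mk (truncIdeal k Z d) (partSigma k e i) ^ d = 0 := by
  rw [← map_pow, Ideal.Quotient.eq_zero_iff_mem]
  exact Ideal.mem_sup_right (Ideal.pow_mem_pow (partSigma_mem_arrowIdeal e hZ i) d)

omit [∀ x y : Q, Finite (x ⟶ y)] in
theorem mk_eq_zero_of_mem_relationIdeal {d : ℕ} {a : PathAlgebra k Q}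
    (ha : a ∈ relationIdeal k Z) : Ideal.Quotient.mkₐ k (truncIdeal k Z d) a = 0 :=
  Ideal.Quotient.eq_zero_iff_mem.mpr (Ideal.mem_sup_left ha)

theorem mk_partSigma_mem_center (hZ : IsSpecial Z) (i : Fin n) (d : ℕ) :
    Ideal.Quotient.mk _ (partSigma k e i) ∈
      Subalgebra.center k (PathAlgebra k Q ⧸ truncIdeal k Z d) := by
  refine Subalgebra.mem_center_iff.mpr fun b => ?_
  obtain ⟨z, rfl⟩ := Ideal.Quotient.mk_surjective b
  exact (commute_map_partSigma e hZ (fun a ha => mk_eq_zero_of_mem_relationIdeal ha) i z).symm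

variable (k) in
theorem exists_algHom_center_X_eq (hZ : IsSpecial Z) (d : ℕ) :
    ∃ ρ : MvPowerSeries (Fin n) k →ₐ[k] Subalgebra.center k (PathAlgebra k Q ⧸ truncIdeal k Z d),
      ∀ i, ρ (MvPowerSeries.X i) = ⟨_, mk_partSigma_mem_center e hZ i d⟩ :=
  exists_mvPowerSeries_algHom_X_eq _ fun i => ⟨d, Subtype.ext (mk_partSigma_pow e hZ i d)⟩

variable (k) in
/-- The homomorphism to the truncation `k Q / (⟨Z⟩ + B ^ d)` which sends the `i`-th variable to the
sum of the primitive cycles at the vertices in the `i`-th part. -/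
def truncHom (hZ : IsSpecial Z) (d : ℕ) :
    PathAlgebra (MvPowerSeries (Fin n) k) Q →ₐ[k] PathAlgebra k Q ⧸ truncIdeal k Z d :=
  liftCentral (exists_algHom_center_X_eq k e hZ d).choose (Ideal.Quotient.mkₐ k _)

variable {e} {d : ℕ}

theorem truncHom_ofPath (hZ : IsSpecial Z) (p : AnyPath Q) :
    truncHom k e hZ d (ofPath _ p) = Ideal.Quotient.mk _ (ofPath k p) := by
  rw [← one_smul (MvPowerSeries (Fin n) k) (ofPath _ p), truncHom, liftCentral_smul_ofPath,
    map_one]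
  exact one_mul _

theorem truncHom_X_pow_smul (hZ : IsSpecial Z) (i : Fin n) (m : ℕ)
    (y : PathAlgebra (MvPowerSeries (Fin n) k) Q) :
    truncHom k e hZ d ((MvPowerSeries.X i : MvPowerSeries (Fin n) k) ^ m • y) =
      Ideal.Quotient.mk _ (partSigma k e i) ^ m * truncHom k e hZ d y := by
  induction y using PathAlgebra.induction_on with
  | zero => rw [smul_zero, map_zero, mul_zero]
  | add x y hx hy => rw [smul_add, map_add, map_add, mul_add, hx, hy]
  | smul f p =>
    rw [smul_smul, truncHom, liftCentral_smul_ofPath, liftCentral_smul_ofPath, map_mul, map_pow,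
      (exists_algHom_center_X_eq k e hZ d).choose_spec i, MulMemClass.coe_mul,
      SubmonoidClass.coe_pow, mul_assoc]

theorem truncHom_sigma (hZ : IsSpecial Z) (x : Q) :
    truncHom k e hZ d (sigma _ Z x) = Ideal.Quotient.mk _ (sigma k Z x) := by
  simp only [sigma_eq_sum hZ, map_sum, truncHom_ofPath]

theorem truncHom_partSigma (hZ : IsSpecial Z) (i : Fin n) :
    truncHom k e hZ d (partSigma _ e i) = Ideal.Quotient.mk _ (partSigma k e i) := by
  simp only [partSigma, map_sum, truncHom_sigma]

theorem truncHom_eq_zero_of_mem_stringIdeal (hZ : IsSpecial Z)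
    {y : PathAlgebra (MvPowerSeries (Fin n) k) Q} (hy : y ∈ stringIdeal Z e MvPowerSeries.X) :
    truncHom k e hZ d y = 0 := by
  suffices h : stringIdeal Z e MvPowerSeries.X ≤ TwoSidedIdeal.ker (truncHom k e hZ d) from
    (TwoSidedIdeal.mem_ker _).mp (h hy)
  rw [stringIdeal_eq_sup_span e hZ]
  refine sup_le (TwoSidedIdeal.span_le.mpr ?_) (TwoSidedIdeal.span_le.mpr ?_)
  · rintro _ ⟨p, hp, rfl⟩
    refine (TwoSidedIdeal.mem_ker _).mpr ?_
    rw [truncHom_ofPath]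
    exact mk_eq_zero_of_mem_relationIdeal (TwoSidedIdeal.subset_span ⟨p, hp, rfl⟩)
  · rintro _ ⟨i, rfl⟩
    refine (TwoSidedIdeal.mem_ker _).mpr ?_
    rw [map_sub, ← pow_one (MvPowerSeries.X i), truncHom_X_pow_smul, pow_one, map_one, mul_one,
      truncHom_partSigma, sub_self]

/-! ### Normal forms and truncations -/

theorem truncHom_extensionSeries_smul_ofPath_eq_zero (hZ : IsSpecial Z) {a : AnyPath Q → k}
    {p : AnyPath Q} (ha : ∀ m ≤ d, a (extend Z p m) = 0) :
    truncHom k e hZ d (extensionSeries e p a • ofPath _ p) = 0 := by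
  classical
  by_cases hp : IsPeriodic Z p
  · obtain ⟨i, hi⟩ := hp.exists_isPeriodicAt e
    have hdvd : MvPowerSeries.X i ^ d ∣ extensionSeries e p a := by
      refine MvPowerSeries.X_pow_dvd_iff.mpr fun α hα => ?_
      rw [coeff_extensionSeries]
      split_ifs with h
      · rw [eq_single_of_mem_exponents hi h, Finsupp.single_eq_same] at hα
        exact ha _ hα.le
      · rfl
    obtain ⟨g, hg⟩ := hdvd
    rw [hg, mul_smul, truncHom_X_pow_smul, mk_partSigma_pow e hZ, zero_mul]
  · have h : ∀ m, a (extend Z p m) = 0 := fun m => by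
      rw [extend_of_not_isPeriodic hp, ← extend_of_not_isPeriodic hp 0]
      exact ha 0 (Nat.zero_le _)
    rw [extensionSeries_eq_zero h, zero_smul, map_zero]

theorem normalForm_single_sub_mem_stringIdeal [DecidableEq (AnyPath Q)] (hZ : IsSpecial Z)
    (p : AnyPath Q) :
    normalForm e hZ (Pi.single p (1 : k)) - ofPath _ p ∈ stringIdeal Z e MvPowerSeries.X :=
  Ideal.Quotient.eq.mp <| map_normalForm_single
    (φ := Ideal.Quotient.mkₐ _ (stringIdeal Z e MvPowerSeries.X).asIdeal) hZ
    (fun _ h => Ideal.Quotient.eq_zero_iff_mem.mpr h) p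

theorem exists_sub_normalForm_mem_stringIdeal (hZ : IsSpecial Z)
    (y : PathAlgebra (MvPowerSeries (Fin n) k) Q) :
    ∃ a, y - normalForm e hZ a ∈ stringIdeal Z e MvPowerSeries.X := by
  obtain ⟨a, ha⟩ := exists_map_normalForm_eq
    (φ := Ideal.Quotient.mkₐ _ (stringIdeal Z e MvPowerSeries.X).asIdeal) hZ
    (fun _ h => Ideal.Quotient.eq_zero_iff_mem.mpr h) y
  exact ⟨a, Ideal.Quotient.eq.mp ha.symm⟩

theorem mk_truncate_single [DecidableEq (AnyPath Q)] (p : AnyPath Q) :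
    Ideal.Quotient.mk (truncIdeal k Z d) (truncate d (Pi.single p 1))
      = Ideal.Quotient.mk _ (ofPath k p) := by
  have h := mk_eq_mk_truncate (a := Pi.single p (1 : k)) (d := d) (z := ofPath k p) fun q _ => by
    obtain rfl | hq := eq_or_ne q p
    · rw [coord_ofPath_self, Pi.single_eq_same]
    · rw [coord_ofPath_of_ne hq, Pi.single_eq_of_ne hq]
  exact Ideal.Quotient.eq.mpr (Ideal.mem_sup_right (Ideal.Quotient.eq.mp h.symm))

theorem truncHom_normalForm (hZ : IsSpecial Z) (a : AnyPath Q → k) :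
    truncHom k e hZ d (normalForm e hZ a) = Ideal.Quotient.mk _ (truncate d a) := by
  classical
  let S := {p : AnyPath Q | p.2.2.length < d} ∪
    Set.image2 (extend Z) {p | IsReduced Z p} (Set.Iic d)
  have hS : S.Finite :=
    (finite_setOf_length_lt Q d).union ((finite_setOf_isReduced hZ).image2 _ (Set.finite_Iic d))
  refine LinearMap.congr_fun (linearMap_pi_ext_of_finite
    (f := (truncHom k e hZ d).toLinearMap ∘ₗ normalForm e hZ)
    (g := (Ideal.Quotient.mkₐ k (truncIdeal k Z d)).toLinearMap ∘ₗ truncate d) hS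
    (fun p _ => ?_) fun a ha => ?_) a
  · change truncHom k e hZ d _ = Ideal.Quotient.mk _ _
    rw [mk_truncate_single, ← truncHom_ofPath hZ, ← sub_eq_zero, ← map_sub]
    exact truncHom_eq_zero_of_mem_stringIdeal hZ (normalForm_single_sub_mem_stringIdeal hZ p)
  · change truncHom k e hZ d _ = Ideal.Quotient.mk _ _
    have htrunc : truncate d a = 0 := by
      rw [truncate_apply]
      refine Finset.sum_eq_zero fun p hp => ?_
      rw [ha p (.inl ((Set.Finite.mem_toFinset _).mp hp)), zero_smul]
    rw [htrunc, map_zero, normalForm_apply, map_sum]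
    refine Finset.sum_eq_zero fun p hp => truncHom_extensionSeries_smul_ofPath_eq_zero hZ ?_
    exact fun m hm => ha _ (.inr ⟨p, (Set.Finite.mem_toFinset _).mp hp, m, hm, rfl⟩)

variable (k e) in
/-- The homomorphism from the path algebra over power series to the product of the truncations. -/
def powerSeriesToTrunc (hZ : IsSpecial Z) : PathAlgebra (MvPowerSeries (Fin n) k) Q →ₐ[k]
    ∀ d, PathAlgebra k Q ⧸ truncIdeal k Z d :=
  AlgHom.pi (truncHom k e hZ)

theorem powerSeriesToTrunc_eq_zero_of_mem_stringIdeal (hZ : IsSpecial Z)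
    {y : PathAlgebra (MvPowerSeries (Fin n) k) Q} (hy : y ∈ stringIdeal Z e MvPowerSeries.X) :
    powerSeriesToTrunc k e hZ y = 0 :=
  funext fun _ => truncHom_eq_zero_of_mem_stringIdeal hZ hy

theorem powerSeriesToTrunc_normalForm (hZ : IsSpecial Z) (a : AnyPath Q → k) :
    powerSeriesToTrunc k e hZ (normalForm e hZ a) = completionToTrunc k Z (ofCoeffs a) :=
  funext fun _ => (truncHom_normalForm hZ a).trans (completionToTrunc_ofCoeffs a _).symm

theorem exists_sub_normalForm_mem_and_powerSeriesToTrunc_eq (hZ : IsSpecial Z)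
    (y : PathAlgebra (MvPowerSeries (Fin n) k) Q) :
    ∃ a, y - normalForm e hZ a ∈ stringIdeal Z e MvPowerSeries.X ∧
      powerSeriesToTrunc k e hZ y = completionToTrunc k Z (ofCoeffs a) := by
  obtain ⟨a, ha⟩ := exists_sub_normalForm_mem_stringIdeal hZ y
  refine ⟨a, ha, ?_⟩
  rw [← powerSeriesToTrunc_normalForm hZ, ← sub_eq_zero, ← map_sub]
  exact powerSeriesToTrunc_eq_zero_of_mem_stringIdeal hZ ha

theorem range_completionToTrunc_eq_range_powerSeriesToTrunc (hZ : IsSpecial Z) :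
    (completionToTrunc k Z).range = (powerSeriesToTrunc k e hZ).range := by
  ext z
  constructor
  · rintro ⟨x, rfl⟩
    obtain ⟨a, rfl⟩ := ofCoeffs_surjective x
    exact ⟨_, powerSeriesToTrunc_normalForm hZ a⟩
  · rintro ⟨y, rfl⟩
    obtain ⟨a, -, ha⟩ := exists_sub_normalForm_mem_and_powerSeriesToTrunc_eq hZ y
    exact ⟨_, ha.symm⟩

theorem ker_powerSeriesToTrunc (hZ : IsSpecial Z) :
    RingHom.ker (powerSeriesToTrunc k e hZ) = (stringIdeal Z e MvPowerSeries.X).asIdeal := by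
  ext y
  refine ⟨fun hy => ?_, powerSeriesToTrunc_eq_zero_of_mem_stringIdeal hZ⟩
  obtain ⟨a, hya, ha⟩ := exists_sub_normalForm_mem_and_powerSeriesToTrunc_eq hZ y
  have h₀ : normalForm e hZ a = 0 := normalForm_eq_zero hZ fun p hp =>
    eq_zero_of_completionToTrunc_ofCoeffs_eq_zero (ha.symm.trans hy) hp
  rwa [h₀, sub_zero] at hya

end TruncHom

end StringAlg

end

theorem proposition1p4_general {k : Type*} [CommRing k] {Q : Type*} [Quiver Q] [Fintype Q]
    [∀ x y : Q, Finite (x ⟶ y)] (Z : Set (StringAlg.AnyPath Q)) (hZ : StringAlg.IsSpecial Z)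
    (n : ℕ) (e : Fin n ≃ StringAlg.NerveParts Z) :
    Nonempty ((StringAlg.Completion k (StringAlg.arrowIdeal k Q).asIdeal ⧸
        StringAlg.closureIdeal k (StringAlg.arrowIdeal k Q).asIdeal
          (StringAlg.relationIdeal k Z).asIdeal) ≃ₐ[k]
      StringAlg.PathAlgebra (MvPowerSeries (Fin n) k) Q ⧸
        (StringAlg.stringIdeal Z e
          (fun i => (MvPowerSeries.X i : MvPowerSeries (Fin n) k))).asIdeal) :=
  StringAlg.nonempty_quotient_algEquiv_of_range_eq
    (StringAlg.range_completionToTrunc_eq_range_powerSeriesToTrunc hZ)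
    StringAlg.ker_completionToTrunc (StringAlg.ker_powerSeriesToTrunc hZ)

theorem proposition1p4 {k : Type*} [Field k] {Q : Type*} [Quiver Q] [Fintype Q]
    [∀ x y : Q, Finite (x ⟶ y)] (hQ : StringAlg.IsBiserial Q)
    (Z : Set (StringAlg.AnyPath Q)) (hlen : ∀ p ∈ Z, 2 ≤ p.2.2.length)
    (hZ : StringAlg.IsSpecial Z)
    (n : ℕ) (e : Fin n ≃ StringAlg.NerveParts Z) :
    Nonempty (StringAlg.CompletedStringAlgebra k Z ≃ₐ[k]
      StringAlg.PathAlgebra (MvPowerSeries (Fin n) k) Q ⧸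
        (StringAlg.stringIdeal Z e
          (fun i => (MvPowerSeries.X i : MvPowerSeries (Fin n) k))).asIdeal) :=
  proposition1p4_general Z hZ n e
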